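/- Let $K$ be an infinite field and let $B=\bigoplus_{n\ge 0}B_n$ be a finitely generated commutative graded $K$-algebra which is an integral domain, generated as a $K$-algebra by $B_1$, with $B_1\ne 0$; in particular every $B_n$ is finite-dimensional and non-zero. A filtration on a finite-dimensional $K$-vector space $W$ is a decreasing family $(\mathcal F_tW)_{t\in\mathbb R}$ of subspaces with $\mathcal F_tW=0$ for $t\gg0$, $\mathcal F_tW=W$ for $t\ll0$, such that $t\mapsto\dim\mathcal F_tW$ is left continuous. For $x\in W$ put $\lambda_{\mathcal F}(x)=\sup\{a\in\mathbb R: x\in\mathcal F_aW\}\in\mathbb R\cup\{+\infty\}$, and for $W\neq 0$ let $\nu_{(W,\mathcal F)}$ be the Borel probability measure on $\mathbb R$ which is the distributional derivative of $t\mapsto-\dim(\mathcal F_tW)/\dim W$. Let $f:\mathbb N\to\mathbb R$ be a function with $\lim_{n\to\infty}f(n)/n=0$. Let every $B_n$ be equipped with a filtration $\mathcal F$ and, for every integer $m\ge0$, with a filtration $\mathcal F^{(m)}$. Assume that $(B,\mathcal F)$ and all $(B,\mathcal F^{(m)})$ are $f$-quasi-filtered, uniformly in $m$: there is $n_0\in\mathbb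 N$ such that, for $\mathcal G=\mathcal F$ and for $\mathcal G=\mathcal F^{(m)}$ with any $m\ge 0$, \[\lambda_{\mathcal G}(x_1\cdots x_l)\ \ge\ \sum_{i=1}^l\bigl(\lambda_{\mathcal G}(x_i)-f(n_i)\bigr)\] for all $l\ge2$ and all $x_i\in B_{n_i}$ with $n_i\ge n_0$ ($1\le i\le l$). Assume moreover that there is a constant $C$ with $\lambda_{\mathcal F}(x)\le Cn$ for all $n\ge1$ and all non-zero $x\in B_n$, and that for every $m\geq 0$ there is a constant $C_m$ with $\lambda_{\mathcal F^{(m)}}(x)\le C_mn$ for all $n\ge1$ and all non-zero $x\in B_n$. Finally assume that $\mathcal F_tB_m\subset\mathcal F^{(m)}_tB_m$ for all $m\ge1$ and $t\in\mathbb R$. Let $\nu_n$ and $\nu_n^{(m)}$ ($n\ge 1$) be the direct images of $\nu_{(B_n,\mathcal F)}$ and $\nu_{(B_n,\mathcal F^{(m)})}$ by $x\mapsto x/n$. Then, as $n\to\infty$, $(\nu_n)$ converges vaguely to a Borel probability measure $\nu$ and, for every $m\geq 0$, $(\nu_n^{(m)})$ converges vaguely to a Borel probability measure $\nu^{(m)}$.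 For every function $\varphi:\mathbb R\to\mathbb R$ which is increasing (in the wide sense), concave and Lipschitz, $\varphi$ is integrable with respect to $\nu$ and all $\nu^{(m)}$, and \[\limsup_{m\to+\infty}\int_{\mathbb R}\varphi\,d\nu^{(m)}\ \ge\ \int_{\mathbb R}\varphi\,d\nu,\] where the left side is taken in $[-\infty,+\infty]$. -/

import Mathlib

open Filter Topology MeasureTheory

/-- An `ℝ`-filtration on a finite-dimensional `K`-vector space `W`: a decreasing family of
subspaces `(F t)`, zero for `t` large, equal to `W` for `-t` large, whose rank is a left
continuous function of `t`. -/
structure RFiltration (K W : Type*) [Field K] [AddCommGroup W] [Module K W]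
    [FiniteDimensional K W] where
  /-- the subspace of index `t` -/
  sub : ℝ → Submodule K W
  antitone_sub : Antitone sub
  eventually_bot : ∀ᶠ t in atTop, sub t = ⊥
  eventually_top : ∀ᶠ t in atBot, sub t = ⊤
  left_cont : ∀ t : ℝ,
    ContinuousWithinAt (fun s : ℝ => (Module.finrank K (sub s) : ℝ)) (Set.Iic t) t

namespace RFiltration

variable {K W : Type*} [Field K] [AddCommGroup W] [Module K W] [FiniteDimensional K W]

/-- The function `lam x = sup {a ∈ ℝ | x ∈ F_a W}`, with values in the extended reals
(it is `+∞` at `0` and finite elsewhere). -/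
noncomputable def lam (F : RFiltration K W) (x : W) : EReal :=
  sSup ((fun a : ℝ => (a : EReal)) '' {a : ℝ | x ∈ F.sub a})

/-- The function `t ↦ - rank (F_t W) / rank W`. -/
noncomputable def negRank (F : RFiltration K W) (t : ℝ) : ℝ :=
  -((Module.finrank K (F.sub t) : ℝ) / (Module.finrank K W : ℝ))

theorem monotone_negRank (F : RFiltration K W) : Monotone F.negRank := by
  intro s t hst
  have h : Module.finrank K (F.sub t) ≤ Module.finrank K (F.sub s) :=
    Submodule.finrank_mono (F.antitone_sub hst)
  unfold negRank
  gcongr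

/-- The Borel measure on `ℝ` attached to a filtered vector space: the derivative, in the sense of
distributions, of the nondecreasing function `t ↦ - rank (F_t W) / rank W`, that is, the
Lebesgue-Stieltjes measure of this function. It is the zero measure if `W = 0`. -/
noncomputable def measure (F : RFiltration K W) : Measure ℝ :=
  F.monotone_negRank.stieltjesFunction.measure

/-- The direct image of `F.measure` by `x ↦ x / n`. -/
noncomputable def scaledMeasure (F : RFiltration K W) (n : ℕ) : Measure ℝ :=
  F.measure.map (fun x : ℝ => (1 / (n : ℝ)) * x)

end RFiltration

/-- The graded algebra `B = ⨁ B_n`, each `B_n` being equipped with a filtration `F n`, satisfies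
the `f`-quasi-filtration inequality
`lam (x_1 ⋯ x_l) ≥ ∑ (lam x_i - f n_i)` for all `l ≥ 2` and all homogeneous elements `x_i` of
degrees `n_i ≥ n₀`. -/
def QuasiFilteredFrom {K B : Type*} [Field K] [CommRing B] [Algebra K B]
    (𝓑 : ℕ → Submodule K B) [∀ n, FiniteDimensional K (𝓑 n)]
    (f : ℕ → ℝ) (n₀ : ℕ) (F : ∀ n, RFiltration K (𝓑 n)) : Prop :=
  ∀ (l : ℕ), 2 ≤ l → ∀ (n : Fin l → ℕ), (∀ i, n₀ ≤ n i) →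
    ∀ (x : ∀ i, 𝓑 (n i)) (y : 𝓑 (∑ i, n i)), (y : B) = ∏ i, (x i : B) →
      ∑ i, ((F (n i)).lam (x i) - (f (n i) : EReal)) ≤ (F (∑ i, n i)).lam y

/-- Vague convergence of a sequence of Borel measures on `ℝ`. -/
def VaguelyConverges (μ : ℕ → Measure ℝ) (ν : Measure ℝ) : Prop :=
  ∀ h : ℝ → ℝ, Continuous h → HasCompactSupport h →
    Tendsto (fun n => ∫ x, h x ∂(μ n)) atTop (𝓝 (∫ x, h x ∂ν))

/-! The core is `exists_forall_eventually_lt_filtRatio`: the distribution of slopes at one large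
level p bounds the asymptotic distribution from below, with a threshold p₀ that depends on f, n₀ and
a lower slope bound a, but not on the filtration. For a single filtration this says that the limsup
of the tail masses at t is at most their liminf at any τ < t, so the tails have a limit off a
countable set. For F^(m) at level p = m, where it contains F, it says that ν([t,∞)) > q forces
ν^(m)([τ,∞)) ≥ q for large m. The slopes also have a common lower bound, so the layer cake formula
and Fatou's lemma turn this into the inequality of integrals.

The bound rests on a growth inequality (`LatticeData.exists_le_finrank_pow_mul`). Let V = B_1 and
let s be its order of growth. There is n₁ such that every S ⊂ V^p satisfies dim(S^k V^(ks+n₁)) ≥ k^s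
dim S for all k ≡ 1 modulo some E depending on S. For S = F_{tp}B_p these products have degree about
k(p+s) and slope about (pt+sa)/(p+s) - f(p)/p. Since dim B_n ~ ℓ n^s, nothing is lost as p → ∞.

The growth inequality comes from a valuation v of Frac B, trivial on K, for which s quotients y_i/x₀
of elements of V have independent values g_i. Up to the dimension of a largest leaf, dimensions
count values. The values of S are commensurable modulo the lattice of the g_i, so the values v(a)^k
g^r with 0 ≤ r_i < k are pairwise distinct: k^s for each value v(a). -/

/-! ### Counting dimensions by values of a valuation -/

section ValuationCount

variable {K B Γ₀ : Type*} [Field K] [CommRing B] [IsDomain B] [Algebra K B]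
  [LinearOrderedCommGroupWithZero Γ₀] (v : Valuation B Γ₀)

theorem Valuation.eq_zero_of_sum_eq_zero_of_injOn {R ι : Type*} [Ring R] (v : Valuation R Γ₀)
    (hv0 : ∀ x, v x = 0 → x = 0)
    (s : Finset ι) (g : ι → R)
    (hg : ∀ i ∈ s, ∀ j ∈ s, g i ≠ 0 → g j ≠ 0 → v (g i) = v (g j) → i = j)
    (hsum : ∑ i ∈ s, g i = 0) : ∀ i ∈ s, g i = 0 := by
  classical
  by_contra! hcon
  obtain ⟨i, hi, hgi⟩ := hcon
  obtain ⟨j, hj, hmax⟩ := Finset.exists_max_image s (fun i => v (g i)) ⟨i, hi⟩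
  have hj0 : v (g j) ≠ 0 := by
    intro h
    have := hmax i hi
    simp only [h, le_zero_iff] at this
    exact hgi (hv0 _ this)
  have hgj : g j ≠ 0 := fun h => hj0 (by simp [h])
  have := Valuation.map_sum_eq_of_lt v (s := s) (f := g) (j := j) hj (by
    intro k hk
    simp only [Finset.mem_sdiff, Finset.mem_singleton] at hk
    refine lt_of_le_of_ne (hmax k hk.1) fun h => hk.2 ?_
    refine hg k hk.1 j hj (fun h0 => ?_) hgj h
    rw [h0, map_zero] at h
    exact hj0 h.symm)
  rw [hsum, map_zero] at this
  exact hj0 this.symm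

/-- A subspace all of whose nonzero elements have the same valuation. -/
def IsValuationLeaf (T : Submodule K B) : Prop :=
  ∀ x ∈ T, ∀ y ∈ T, x ≠ 0 → y ≠ 0 → v x = v y

/-- The nonzero elements of a leaf share one value, so the nonzero terms of a sum ∑ w_i t_i have
distinct values and cannot cancel. Hence T^ι embeds in W. -/
theorem card_mul_finrank_leaf_le (hv0 : ∀ x, v x = 0 → x = 0)
    {T W : Submodule K B} [FiniteDimensional K T] [FiniteDimensional K W]
    (hT : IsValuationLeaf v T) {ι : Type*} [Fintype ι] (w : ι → B) (hw0 : ∀ i, w i ≠ 0)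
    (hw : Function.Injective fun i => v (w i)) (hW : ∀ i, ∀ u ∈ T, w i * u ∈ W) :
    Fintype.card ι * Module.finrank K T ≤ Module.finrank K W := by
  classical
  let b := Module.finBasis K T
  let F : (ι → T) →ₗ[K] W :=
    { toFun := fun t => ⟨∑ i, w i * (t i : B), Submodule.sum_mem _ fun i _ => hW i _ (t i).2⟩
      map_add' := by
        intro x y
        ext
        simp [mul_add, Finset.sum_add_distrib]
      map_smul' := by
        intro c x
        ext
        simp [Finset.smul_sum] }
  have hF : Function.Injective F := by
    rw [← LinearMap.ker_eq_bot, LinearMap.ker_eq_bot']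
    intro t ht
    have hsum : ∑ i, w i * (t i : B) = 0 := congrArg Subtype.val ht
    have := Valuation.eq_zero_of_sum_eq_zero_of_injOn v hv0 Finset.univ (fun i => w i * (t i : B))
      (by
        intro i _ j _ hi hj hij
        rw [map_mul, map_mul] at hij
        have hti : (t i : B) ≠ 0 := right_ne_zero_of_mul hi
        have htj : (t j : B) ≠ 0 := right_ne_zero_of_mul hj
        rw [hT _ (t i).2 _ (t j).2 hti htj] at hij
        exact hw (mul_right_cancel₀ (fun h => htj (hv0 _ h)) hij)) hsum
    ext i
    have h1 := this i (Finset.mem_univ _)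
    simpa [hw0 i] using h1
  have := LinearMap.finrank_le_finrank_of_injective hF
  rwa [Module.finrank_pi_fintype, Finset.sum_const, Finset.card_univ, smul_eq_mul] at this

omit [IsDomain B] in
theorem isValuationLeaf_one (hvK : ∀ c : K, c ≠ 0 → v (algebraMap K B c) = 1) :
    IsValuationLeaf v (1 : Submodule K B) := by
  intro x hx y hy hx0 hy0
  rw [Submodule.mem_one] at hx hy
  obtain ⟨c, rfl⟩ := hx
  obtain ⟨d, rfl⟩ := hy
  rw [hvK c (by rintro rfl; simp at hx0), hvK d (by rintro rfl; simp at hy0)]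

theorem finrank_one_submodule : Module.finrank K (1 : Submodule K B) = 1 := by
  rw [Submodule.one_eq_span]
  exact finrank_span_singleton one_ne_zero

theorem card_le_finrank_of_valuation_injective (hv0 : ∀ x, v x = 0 → x = 0)
    (hvK : ∀ c : K, c ≠ 0 → v (algebraMap K B c) = 1)
    {W : Submodule K B} [FiniteDimensional K W]
    {ι : Type*} [Fintype ι] (w : ι → B) (hw0 : ∀ i, w i ≠ 0)
    (hw : Function.Injective fun i => v (w i)) (hW : ∀ i, w i ∈ W) :
    Fintype.card ι ≤ Module.finrank K W := by
  have : FiniteDimensional K (1 : Submodule K B) := by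
    rw [Submodule.one_eq_span]; infer_instance
  have := card_mul_finrank_leaf_le v hv0 (isValuationLeaf_one v hvK) w hw0 hw (W := W) (by
    intro i u hu
    obtain ⟨c, rfl⟩ := Submodule.mem_one.1 hu
    rw [mul_comm, ← Algebra.smul_def]
    exact W.smul_mem c (hW i))
  rwa [finrank_one_submodule, mul_one] at this

omit [IsDomain B] in
theorem valuation_smul (hvK : ∀ c : K, c ≠ 0 → v (algebraMap K B c) = 1) (c : K) (x : B) :
    v (c • x) ≤ v x := by
  rw [Algebra.smul_def, map_mul]
  by_cases hc : c = 0
  · simp [hc]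
  · rw [hvK c hc, one_mul]

/-- The elements of `S` whose valuation is at most `γ`. -/
def valuationBall (hvK : ∀ c : K, c ≠ 0 → v (algebraMap K B c) = 1) (S : Submodule K B) (γ : Γ₀) :
    Submodule K B where
  carrier := {x | x ∈ S ∧ v x ≤ γ}
  add_mem' := fun ha hb => ⟨S.add_mem ha.1 hb.1, v.map_add_le ha.2 hb.2⟩
  zero_mem' := ⟨S.zero_mem, by simp⟩
  smul_mem' := fun c _ hx => ⟨S.smul_mem c hx.1, (valuation_smul v hvK c _).trans hx.2⟩

omit [IsDomain B] in
theorem exists_valuation_min (hvK : ∀ c : K, c ≠ 0 → v (algebraMap K B c) = 1)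
    (S : Submodule K B) [FiniteDimensional K S] (hS : S ≠ ⊥) :
    ∃ x ∈ S, x ≠ 0 ∧ ∀ y ∈ S, y ≠ 0 → v x ≤ v y := by
  obtain ⟨x₁, hx₁, hx₁0⟩ := S.ne_bot_iff.1 hS
  let A : Set B := {x | x ∈ S ∧ x ≠ 0}
  have hA : A.Nonempty := ⟨x₁, hx₁, hx₁0⟩
  -- Balls shrink strictly when the value drops, so an element whose ball has least dimension has
  -- least value.
  let g : B → ℕ := fun x => Module.finrank K (valuationBall v hvK S (v x))
  let x := Function.argminOn g A hA
  have hx : x ∈ A := Function.argminOn_mem g A hA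
  refine ⟨x, hx.1, hx.2, fun y hy hy0 => ?_⟩
  by_contra! hlt
  have h1 : g x ≤ g y := Function.argminOn_le g A ⟨hy, hy0⟩
  have hle : valuationBall v hvK S (v x) ≤ S := fun z hz => hz.1
  have : FiniteDimensional K (valuationBall v hvK S (v x)) :=
    Submodule.finiteDimensional_of_le hle
  have h2 : valuationBall v hvK S (v y) < valuationBall v hvK S (v x) := by
    refine lt_of_le_of_ne (fun z hz => ⟨hz.1, hz.2.trans hlt.le⟩) fun h => ?_
    have : x ∈ valuationBall v hvK S (v y) := h ▸ ⟨hx.1, le_rfl⟩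
    exact absurd this.2 (not_le.2 hlt)
  exact absurd h1 (not_le.2 (Submodule.finrank_lt_finrank_of_lt h2))

omit [IsDomain B] in
-- The ball of least value in S is a leaf, hence of dimension at most f. It contributes one value,
-- and induction applies to a complement, whose nonzero elements do not have that value.
theorem exists_finset_finrank_le (hvK : ∀ c : K, c ≠ 0 → v (algebraMap K B c) = 1) (f : ℕ)
    (S : Submodule K B) [FiniteDimensional K S]
    (hf : ∀ T ≤ S, IsValuationLeaf v T → Module.finrank K T ≤ f) :
    ∃ A : Finset B, (∀ a ∈ A, a ∈ S ∧ a ≠ 0) ∧ Set.InjOn v A ∧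
      Module.finrank K S ≤ f * A.card := by
  classical
  induction hd : Module.finrank K S using Nat.strong_induction_on generalizing S with
  | _ d ih =>
  by_cases hS : S = ⊥
  · refine ⟨∅, by simp, by simp, ?_⟩
    subst hS
    simp [← hd]
  obtain ⟨x, hx, hx0, hmin⟩ := exists_valuation_min v hvK S hS
  set T := valuationBall v hvK S (v x) with hTdef
  have hTS : T ≤ S := fun z hz => hz.1
  have hTv : ∀ z ∈ T, z ≠ 0 → v z = v x := fun z hz hz0 => le_antisymm hz.2 (hmin z hz.1 hz0)
  have hxT : x ∈ T := ⟨hx, le_rfl⟩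
  have hTf : Module.finrank K T ≤ f :=
    hf T hTS fun a ha b hb ha0 hb0 => by rw [hTv a ha ha0, hTv b hb hb0]
  obtain ⟨U', hU'⟩ := Submodule.exists_isCompl (T.comap S.subtype)
  set U := U'.map S.subtype with hUdef
  have hUS : U ≤ S := Submodule.map_subtype_le _ _
  have : FiniteDimensional K U := Submodule.finiteDimensional_of_le hUS
  have : FiniteDimensional K T := Submodule.finiteDimensional_of_le hTS
  have hrank : Module.finrank K T + Module.finrank K U = Module.finrank K S := by
    have h1 := Submodule.finrank_add_eq_of_isCompl hU'
    have h2 : Module.finrank K (T.comap S.subtype) = Module.finrank K T :=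
      (Submodule.comapSubtypeEquivOfLe hTS).finrank_eq
    have h3 : Module.finrank K U = Module.finrank K U' :=
      Submodule.finrank_map_subtype_eq _ _
    omega
  have hTpos : 0 < Module.finrank K T := by
    rw [Module.finrank_pos_iff_exists_ne_zero]
    exact ⟨⟨x, hxT⟩, fun h => hx0 (congrArg Subtype.val h)⟩
  have hUT : ∀ z ∈ U, z ∈ T → z = 0 := by
    rintro _ ⟨z, hz, rfl⟩ hzT
    have : z ∈ (T.comap S.subtype) ⊓ U' := ⟨hzT, hz⟩
    rw [hU'.inf_eq_bot] at this
    simpa using this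
  obtain ⟨A, hA, hinj, hcard⟩ := ih (Module.finrank K U) (by omega) U
    (fun T' hT' h => hf T' (hT'.trans hUS) h) rfl
  have hAx : ∀ a ∈ A, v a ≠ v x := by
    intro a ha hax
    exact (hA a ha).2 (hUT a (hA a ha).1 ⟨hUS (hA a ha).1, hax.le⟩)
  have hxA : x ∉ A := fun h => hAx x h rfl
  refine ⟨insert x A, ?_, ?_, ?_⟩
  · intro a ha
    rcases Finset.mem_insert.1 ha with rfl | ha
    · exact ⟨hx, hx0⟩
    · exact ⟨hUS (hA a ha).1, (hA a ha).2⟩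
  · rw [Finset.coe_insert, Set.injOn_insert (by simpa using hxA)]
    refine ⟨hinj, ?_⟩
    rintro ⟨a, ha, hax⟩
    exact hAx a ha hax
  · rw [Finset.card_insert_of_notMem hxA, mul_add, mul_one]
    omega

end ValuationCount

/-! ### Box monomials and the growth inequality -/

/-- Put δ = a/b. Then δ^E and δ^k both lie in the lattice generated by g, hence so does δ = δ^k
(δ^E)^(-j), say δ = g^q. Independence gives q k = r' - r, whose entries are smaller than k in
absolute value, so q = 0. -/
theorem eq_of_pow_mul_lattice_eq {Γ₀ : Type*} [LinearOrderedCommGroupWithZero Γ₀] {s : ℕ}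
    {g : Fin s → Γ₀} (hg0 : ∀ i, g i ≠ 0)
    (hg : ∀ m : Fin s → ℤ, ∏ i, g i ^ m i = 1 → m = 0)
    {a b : Γ₀} (ha : a ≠ 0) (hb : b ≠ 0) {E j k : ℕ} (hk : k = 1 + E * j) {m : Fin s → ℤ}
    (hE : a ^ E = b ^ E * ∏ i, g i ^ m i) {r r' : Fin s → ℕ} (hr : ∀ i, r i < k)
    (hr' : ∀ i, r' i < k)
    (h : a ^ k * ∏ i, g i ^ r i = b ^ k * ∏ i, g i ^ r' i) : a = b ∧ r = r' := by
  set δ := a / b with hδ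
  have hδ0 : δ ≠ 0 := div_ne_zero ha hb
  have hprod : ∀ q : Fin s → ℤ, ∏ i, g i ^ q i ≠ 0 := fun q =>
    Finset.prod_ne_zero_iff.2 fun i _ => zpow_ne_zero _ (hg0 i)
  have hadd : ∀ q q' : Fin s → ℤ, ∏ i, g i ^ (q i + q' i) =
      (∏ i, g i ^ q i) * ∏ i, g i ^ q' i := fun q q' => by
    rw [← Finset.prod_mul_distrib]
    exact Finset.prod_congr rfl fun i _ => zpow_add₀ (hg0 i) _ _
  have hmul : ∀ (q : Fin s → ℤ) (c : ℤ), ∏ i, g i ^ (q i * c) = (∏ i, g i ^ q i) ^ c :=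
    fun q c => by
      rw [← Finset.prod_zpow]
      exact Finset.prod_congr rfl fun i _ => zpow_mul _ _ _
  have h1 : δ ^ k * ∏ i, g i ^ (r i : ℤ) = ∏ i, g i ^ (r' i : ℤ) := by
    simp only [zpow_natCast]
    rw [hδ, div_pow, div_mul_eq_mul_div, h, mul_div_cancel_left₀ _ (pow_ne_zero _ hb)]
  have h2 : δ ^ E = ∏ i, g i ^ m i := by
    rw [hδ, div_pow, hE, mul_div_cancel_left₀ _ (pow_ne_zero _ hb)]
  have h3 : δ ^ k = ∏ i, g i ^ ((r' i : ℤ) - r i) := by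
    have := hadd (fun i => (r' i : ℤ) - r i) (fun i => (r i : ℤ))
    simp only [sub_add_cancel] at this
    rw [this] at h1
    exact mul_right_cancel₀ (hprod _) h1
  have h4 : δ = ∏ i, g i ^ (((r' i : ℤ) - r i) + m i * (-(j : ℤ))) := by
    rw [hadd (fun i => (r' i : ℤ) - r i) (fun i => m i * (-(j : ℤ))), hmul, ← h2, ← h3, hk,
      pow_add, pow_one, pow_mul, zpow_neg, zpow_natCast, mul_assoc,
      mul_inv_cancel₀ (pow_ne_zero _ (pow_ne_zero _ hδ0)), mul_one]
  set q : Fin s → ℤ := fun i => ((r' i : ℤ) - r i) + m i * (-(j : ℤ)) with hq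
  have h5 : (fun i => q i * k + -((r' i : ℤ) - r i)) = 0 := by
    apply hg
    rw [hadd (fun i => q i * k) (fun i => -((r' i : ℤ) - r i)), hmul, ← h4, zpow_natCast, h3,
      ← hadd]
    simp
  have h6 : ∀ i, q i = 0 := by
    intro i
    have h7 := congrFun h5 i
    simp only [Pi.zero_apply] at h7
    have hri := hr i
    have hri' := hr' i
    by_contra hne
    rcases lt_or_gt_of_ne hne with hlt | hgt
    · have : q i * k ≤ (-1) * k := by gcongr; omega
      omega
    · have : 1 * (k : ℤ) ≤ q i * k := by gcongr; omega
      omega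
  constructor
  · have : δ = 1 := by
      rw [h4]
      refine Finset.prod_eq_one fun i _ => ?_
      rw [show (r' i : ℤ) - r i + m i * (-(j : ℤ)) = 0 from h6 i, zpow_zero]
    exact (div_eq_one_iff_eq hb).1 this
  · funext i
    have h7 := congrFun h5 i
    simp only [Pi.zero_apply, h6 i] at h7
    omega

section BoxCount

variable {K B Γ₀ : Type*} [Field K] [CommRing B] [IsDomain B] [Algebra K B]
  [LinearOrderedCommGroupWithZero Γ₀] (v : Valuation B Γ₀)

/-- The monomial of degree `k * s` in `y₁, …, yₛ, x₀` with exponent `r i ≤ k` at `y i`. -/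
def boxMonomial {s : ℕ} (x₀ : B) (y : Fin s → B) (k : ℕ) (r : Fin s → Fin k) : B :=
  ∏ i, (y i ^ (r i : ℕ) * x₀ ^ (k - (r i : ℕ)))

omit [IsDomain B] in
theorem boxMonomial_mem {V : Submodule K B} {s : ℕ} {x₀ : B} {y : Fin s → B} (hx : x₀ ∈ V)
    (hy : ∀ i, y i ∈ V) (k : ℕ) (r : Fin s → Fin k) : boxMonomial x₀ y k r ∈ V ^ (k * s) := by
  have h : ∀ t : Finset (Fin s),
      ∏ i ∈ t, (y i ^ (r i : ℕ) * x₀ ^ (k - (r i : ℕ))) ∈ V ^ (k * t.card) := by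
    classical
    intro t
    induction t using Finset.induction_on with
    | empty => simpa using Submodule.one_le.1 (le_refl (1 : Submodule K B))
    | insert a t ha ih =>
      rw [Finset.prod_insert ha, Finset.card_insert_of_notMem ha, mul_add, mul_one, add_comm,
        pow_add]
      refine Submodule.mul_mem_mul ?_ ih
      have hk : (r a : ℕ) + (k - r a) = k := by have := (r a).2; omega
      have hmem := Submodule.mul_mem_mul (Submodule.pow_mem_pow _ (hy a) (r a))
        (Submodule.pow_mem_pow _ hx (k - r a))
      rwa [← pow_add, hk] at hmem
  simpa [boxMonomial] using h Finset.univ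

theorem boxMonomial_ne_zero {s : ℕ} {x₀ : B} {y : Fin s → B} (hx : x₀ ≠ 0)
    (hy : ∀ i, y i ≠ 0) (k : ℕ) (r : Fin s → Fin k) : boxMonomial x₀ y k r ≠ 0 :=
  Finset.prod_ne_zero_iff.2 fun i _ => mul_ne_zero (pow_ne_zero _ (hy i)) (pow_ne_zero _ hx)

omit [IsDomain B] in
theorem valuation_boxMonomial {s : ℕ} {x₀ : B} {y : Fin s → B} (hx : v x₀ ≠ 0)
    (k : ℕ) (r : Fin s → Fin k) :
    v (boxMonomial x₀ y k r) = v x₀ ^ (k * s) * ∏ i, (v (y i) / v x₀) ^ (r i : ℕ) := by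
  have : v x₀ ^ (k * s) = ∏ _i : Fin s, v x₀ ^ k := by simp [pow_mul]
  rw [this, ← Finset.prod_mul_distrib, boxMonomial, map_prod]
  refine Finset.prod_congr rfl fun i _ => ?_
  rw [map_mul, map_pow, map_pow, div_pow, mul_div_assoc', mul_comm (v x₀ ^ k), mul_div_assoc]
  congr 1
  rw [pow_sub₀ _ hx (r i).2.le, div_eq_mul_inv]

/-- A valuation `v`, trivial on constants, with elements of `V` whose values are independent,
as many as the order of growth of the powers of `V`. -/
structure LatticeData (V : Submodule K B) (s : ℕ) (x₀ : B) (y : Fin s → B) (C : ℕ) : Prop where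
  zero_of_zero : ∀ x, v x = 0 → x = 0
  trivial_on : ∀ c : K, c ≠ 0 → v (algebraMap K B c) = 1
  mem_x : x₀ ∈ V
  x_ne : x₀ ≠ 0
  mem_y : ∀ i, y i ∈ V
  y_ne : ∀ i, y i ≠ 0
  indep : ∀ m : Fin s → ℤ, ∏ i, (v (y i) / v x₀) ^ m i = 1 → m = 0
  growth : ∀ n, Module.finrank K ↥(V ^ n) ≤ C * (n + 1) ^ s

namespace LatticeData

variable {v} {V : Submodule K B} {s : ℕ} {x₀ : B} {y : Fin s → B} {C : ℕ}

omit [IsDomain B] in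
theorem val_ne (D : LatticeData v V s x₀ y C) {x : B} (hx : x ≠ 0) : v x ≠ 0 :=
  fun h => hx (D.zero_of_zero x h)

/-- Multiplying T by the box monomials with k = n + 1 gives k^s dim T ≤ dim V^(ks+n) ≤ C (k(s+2))^s.
The factor k^s cancels, so the bound does not depend on n. -/
theorem leaf_finrank_le [FiniteDimensional K V] (D : LatticeData v V s x₀ y C) {n : ℕ}
    {T : Submodule K B} (hTV : T ≤ V ^ n) (hT : IsValuationLeaf v T) :
    Module.finrank K T ≤ C * (s + 2) ^ s := by
  have hfin : ∀ n, FiniteDimensional K ↥(V ^ n) := fun n =>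
    Module.Finite.iff_fg.2 ((Module.Finite.iff_fg.1 ‹_›).pow n)
  have := hfin n
  have : FiniteDimensional K T := Submodule.finiteDimensional_of_le hTV
  set k := n + 1
  have := hfin (k * s + n)
  have h1 := card_mul_finrank_leaf_le v D.zero_of_zero hT (W := V ^ (k * s + n))
    (boxMonomial x₀ y k) (boxMonomial_ne_zero D.x_ne D.y_ne k) (by
      intro r r' h
      simp only at h
      rw [valuation_boxMonomial v (D.val_ne D.x_ne), valuation_boxMonomial v (D.val_ne D.x_ne)] at h
      have h' := mul_left_cancel₀ (pow_ne_zero _ (D.val_ne D.x_ne)) h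
      -- With a = b = 1, E = 1 and m = 0 the arithmetic lemma is just the injectivity of r ↦ g^r on
      -- the box.
      have := (eq_of_pow_mul_lattice_eq (fun i => div_ne_zero (D.val_ne (D.y_ne i))
        (D.val_ne D.x_ne)) D.indep (a := 1) (b := 1) one_ne_zero one_ne_zero
        (E := 1) (j := n) (k := k) (m := 0) (by omega) (by simp) (r := fun i => r i)
        (r' := fun i => r' i) (fun i => (r i).2) (fun i => (r' i).2) (by simpa using h')).2
      funext i
      exact Fin.ext (congrFun this i))
    (by
      intro r u hu
      rw [pow_add]
      exact Submodule.mul_mem_mul (boxMonomial_mem D.mem_x D.mem_y k r) (hTV hu))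
  have h2 := h1.trans (D.growth _)
  simp only [Fintype.card_fun, Fintype.card_fin] at h2
  have h3 : C * (k * s + n + 1) ^ s ≤ k ^ s * (C * (s + 2) ^ s) := by
    calc C * (k * s + n + 1) ^ s ≤ C * (k * (s + 2)) ^ s := by
          gcongr
          rw [mul_add]; omega
      _ = _ := by rw [mul_pow]; ring
  exact Nat.le_of_mul_le_mul_left (h2.trans h3) (by positivity)

/-- If v(a)/v(b) were independent of the lattice, the products a^i b^(k-i) with box monomials would
give k^(s+1) distinct values in V^(k(p+s)), against growth of order k^s. -/
theorem torsion [FiniteDimensional K V] (D : LatticeData v V s x₀ y C) {p : ℕ} {a b : B}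
    (ha : a ∈ V ^ p) (hb : b ∈ V ^ p) (ha0 : a ≠ 0) (hb0 : b ≠ 0) :
    ∃ E : ℕ, 0 < E ∧ ∃ m : Fin s → ℤ, v a ^ E = v b ^ E * ∏ i, (v (y i) / v x₀) ^ m i := by
  by_contra! hcon
  have hfin : ∀ n, FiniteDimensional K ↥(V ^ n) := fun n =>
    Module.Finite.iff_fg.2 ((Module.Finite.iff_fg.1 ‹_›).pow n)
  set g : Fin s → Γ₀ := fun i => v (y i) / v x₀ with hg
  have hg0 : ∀ i, g i ≠ 0 := fun i => div_ne_zero (D.val_ne (D.y_ne i)) (D.val_ne D.x_ne)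
  have hva := D.val_ne ha0
  have hvb := D.val_ne hb0
  have key : ∀ k : ℕ, 0 < k → k ^ s * k ≤ C * (k * (p + s) + 1) ^ s := by
    intro k hk
    have := hfin (k * (p + s))
    let w : (Fin s → Fin k) × Fin k → B := fun z =>
      a ^ (z.2 : ℕ) * b ^ (k - (z.2 : ℕ)) * boxMonomial x₀ y k z.1
    have hw := card_le_finrank_of_valuation_injective v D.zero_of_zero D.trivial_on
      (W := V ^ (k * (p + s))) w
      (fun z => mul_ne_zero (mul_ne_zero (pow_ne_zero _ ha0) (pow_ne_zero _ hb0))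
        (boxMonomial_ne_zero D.x_ne D.y_ne k _)) ?_ ?_
    · simp only [Fintype.card_prod, Fintype.card_fun, Fintype.card_fin] at hw
      exact hw.trans (D.growth _)
    · have aux : ∀ z z' : (Fin s → Fin k) × Fin k, v (w z) = v (w z') → ¬ (z'.2 : ℕ) < z.2 := by
        intro z z' h hlt
        simp only [w, map_mul, map_pow, valuation_boxMonomial v (D.val_ne D.x_ne)] at h
        apply hcon (z.2 - z'.2) (by omega) (fun i => (z'.1 i : ℤ) - (z.1 i : ℤ))
        have hz := z.2.2
        obtain ⟨e, he⟩ : ∃ e, (z.2 : ℕ) = z'.2 + e := ⟨z.2 - z'.2, by omega⟩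
        have h1 : k - (z'.2 : ℕ) = (k - z.2) + e := by omega
        have h2 : (z.2 : ℕ) - z'.2 = e := by omega
        have h3 : ∏ i, (v (y i) / v x₀) ^ ((z'.1 i : ℤ) - (z.1 i : ℤ)) =
            (∏ i, (v (y i) / v x₀) ^ (z'.1 i : ℕ)) / ∏ i, (v (y i) / v x₀) ^ (z.1 i : ℕ) := by
          rw [← Finset.prod_div_distrib]
          refine Finset.prod_congr rfl fun i _ => ?_
          rw [zpow_sub₀ (hg0 i), zpow_natCast, zpow_natCast]
        rw [h2, h3, mul_div_assoc', eq_div_iff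
          (Finset.prod_ne_zero_iff.2 fun i _ => pow_ne_zero _ (hg0 i))]
        rw [h1, pow_add] at h
        conv at h => lhs; rw [he, pow_add]
        have hne : v a ^ (z'.2 : ℕ) * v b ^ (k - (z.2 : ℕ)) * v x₀ ^ (k * s) ≠ 0 :=
          mul_ne_zero (mul_ne_zero (pow_ne_zero _ hva) (pow_ne_zero _ hvb))
            (pow_ne_zero _ (D.val_ne D.x_ne))
        apply mul_left_cancel₀ hne
        have h4 : k - ((z'.2 : ℕ) + e) = k - z.2 := by rw [he]
        rw [h4] at h
        simp only [mul_assoc, mul_left_comm, mul_comm, hg] at h ⊢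
        exact h
      intro z z' h
      have h2 : z.2 = z'.2 := Fin.ext (by
        have := aux z z' h
        have := aux z' z h.symm
        omega)
      refine Prod.ext ?_ h2
      simp only [w, map_mul, h2] at h
      have h' := mul_left_cancel₀ (mul_ne_zero (by simpa using pow_ne_zero _ hva)
        (by simpa using pow_ne_zero _ hvb)) h
      rw [valuation_boxMonomial v (D.val_ne D.x_ne), valuation_boxMonomial v (D.val_ne D.x_ne)]
        at h'
      have h'' := mul_left_cancel₀ (pow_ne_zero _ (D.val_ne D.x_ne)) h'
      have := (eq_of_pow_mul_lattice_eq hg0 D.indep (a := 1) (b := 1) one_ne_zero one_ne_zero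
        (E := 1) (j := k - 1) (k := k) (m := 0) (by omega) (by simp) (r := fun i => z.1 i)
        (r' := fun i => z'.1 i) (fun i => (z.1 i).2) (fun i => (z'.1 i).2)
        (by simpa using h'')).2
      funext i
      exact Fin.ext (congrFun this i)
    · intro z
      have hz := z.2.2
      have h1 : k * (p + s) = p * z.2 + p * (k - z.2) + k * s := by
        rw [← mul_add p, Nat.add_sub_cancel' hz.le]
        ring
      rw [h1, pow_add, pow_add, pow_mul, pow_mul]
      exact Submodule.mul_mem_mul (Submodule.mul_mem_mul (Submodule.pow_mem_pow _ ha _)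
        (Submodule.pow_mem_pow _ hb _)) (boxMonomial_mem D.mem_x D.mem_y k _)
  -- Any k above C (p+s+1)^s contradicts `key`.
  have h1 := key (C * (p + s + 1) ^ s + 1) (by omega)
  set k := C * (p + s + 1) ^ s + 1
  have h2 : C * (k * (p + s) + 1) ^ s ≤ k ^ s * (C * (p + s + 1) ^ s) := by
    calc C * (k * (p + s) + 1) ^ s ≤ C * (k * (p + s + 1)) ^ s := by
          gcongr
          rw [mul_add k (p + s) 1, mul_one]
          exact Nat.add_le_add_left (Nat.le_add_left 1 _) _
      _ = _ := by rw [mul_pow]; ring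
  have := Nat.le_of_mul_le_mul_left (h1.trans h2) (by positivity)
  omega

theorem exists_common_torsion [FiniteDimensional K V] (D : LatticeData v V s x₀ y C) {p : ℕ}
    (A : Finset B) (hA : ∀ a ∈ A, a ∈ V ^ p ∧ a ≠ 0) :
    ∃ E : ℕ, 0 < E ∧ ∀ a ∈ A, ∀ b ∈ A, ∃ m : Fin s → ℤ,
      v a ^ E = v b ^ E * ∏ i, (v (y i) / v x₀) ^ m i := by
  classical
  have h : ∀ a b : B, ∃ E : ℕ, 0 < E ∧ (a ∈ A → b ∈ A → ∃ m : Fin s → ℤ,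
      v a ^ E = v b ^ E * ∏ i, (v (y i) / v x₀) ^ m i) := by
    intro a b
    by_cases hab : a ∈ A ∧ b ∈ A
    · obtain ⟨E, hE, m, hm⟩ := D.torsion (hA a hab.1).1 (hA b hab.2).1 (hA a hab.1).2
        (hA b hab.2).2
      exact ⟨E, hE, fun _ _ => ⟨m, hm⟩⟩
    · exact ⟨1, one_pos, fun ha hb => absurd ⟨ha, hb⟩ hab⟩
  choose E hE hm using h
  refine ⟨∏ z ∈ A ×ˢ A, E z.1 z.2, Finset.prod_pos fun z _ => hE _ _, fun a ha b hb => ?_⟩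
  obtain ⟨m, hm⟩ := hm a b ha hb
  obtain ⟨c, hc⟩ := Finset.dvd_prod_of_mem (fun z : B × B => E z.1 z.2)
    (Finset.mk_mem_product ha hb)
  refine ⟨fun i => m i * c, ?_⟩
  rw [hc, pow_mul, hm, mul_pow, ← pow_mul, ← Finset.prod_pow]
  congr 1
  refine Finset.prod_congr rfl fun i _ => ?_
  rw [zpow_mul, zpow_natCast]

/-- Let f be the largest dimension of a leaf in any V^n, attained by T in V^n₁. S has at least dim S
/ f values. For representatives a of them, the elements a^k times box monomials have distinct values
when k ≡ 1 mod E, and multiplying them by T restores the factor f exactly. -/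
theorem exists_le_finrank_pow_mul [FiniteDimensional K V] (D : LatticeData v V s x₀ y C) :
    ∃ n₁ : ℕ, ∀ (p : ℕ) (S : Submodule K B), S ≤ V ^ p → ∃ E : ℕ, 0 < E ∧
      ∀ j k : ℕ, k = 1 + E * j →
        k ^ s * Module.finrank K S ≤ Module.finrank K ↥(S ^ k * V ^ (k * s + n₁)) := by
  classical
  have hfin : ∀ n, FiniteDimensional K ↥(V ^ n) := fun n =>
    Module.Finite.iff_fg.2 ((Module.Finite.iff_fg.1 ‹_›).pow n)
  let P : ℕ → Prop := fun d => ∃ n, ∃ T ≤ V ^ n, IsValuationLeaf v T ∧ Module.finrank K T = d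
  have hP0 : P 0 := ⟨0, ⊥, bot_le, fun x hx y _ hx0 _ => absurd hx hx0, finrank_bot K B⟩
  have hPb : ∀ d, P d → d ≤ C * (s + 2) ^ s := by
    rintro d ⟨n, T, hTV, hT, rfl⟩
    exact D.leaf_finrank_le hTV hT
  obtain ⟨n₁, T, hTV, hT, hTf⟩ : P (Nat.findGreatest P (C * (s + 2) ^ s)) :=
    Nat.findGreatest_spec (m := 0) (Nat.zero_le _) hP0
  set f := Nat.findGreatest P (C * (s + 2) ^ s)
  have hmax : ∀ n, ∀ T' ≤ V ^ n, IsValuationLeaf v T' → Module.finrank K T' ≤ f :=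
    fun n T' hT' h => Nat.le_findGreatest (D.leaf_finrank_le hT' h) ⟨n, T', hT', h, rfl⟩
  refine ⟨n₁, fun p S hS => ?_⟩
  have := hfin p
  have := hfin n₁
  have : FiniteDimensional K S := Submodule.finiteDimensional_of_le hS
  have : FiniteDimensional K T := Submodule.finiteDimensional_of_le hTV
  obtain ⟨A, hA, hinj, hcard⟩ := exists_finset_finrank_le v D.trivial_on f S
    (fun T' hT' h => hmax p T' (hT'.trans hS) h)
  obtain ⟨E, hE, htor⟩ := D.exists_common_torsion A (fun a ha => ⟨hS (hA a ha).1, (hA a ha).2⟩)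
  refine ⟨E, hE, fun j k hk => ?_⟩
  have : FiniteDimensional K ↥(S ^ k * V ^ (k * s + n₁)) :=
    Module.Finite.iff_fg.2 (((Module.Finite.iff_fg.1 ‹FiniteDimensional K S›).pow k).mul
      (Module.Finite.iff_fg.1 (hfin _)))
  have h1 := card_mul_finrank_leaf_le v D.zero_of_zero hT (W := S ^ k * V ^ (k * s + n₁))
    (fun z : A × (Fin s → Fin k) => (z.1 : B) ^ k * boxMonomial x₀ y k z.2)
    (fun z => mul_ne_zero (pow_ne_zero _ (hA _ z.1.2).2)
      (boxMonomial_ne_zero D.x_ne D.y_ne k _))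
    (by
      intro z z' h
      simp only [map_mul, map_pow, valuation_boxMonomial v (D.val_ne D.x_ne)] at h
      obtain ⟨m, hm⟩ := htor _ z.1.2 _ z'.1.2
      have h' : v (z.1 : B) ^ k * ∏ i, (v (y i) / v x₀) ^ (z.2 i : ℕ) =
          v (z'.1 : B) ^ k * ∏ i, (v (y i) / v x₀) ^ (z'.2 i : ℕ) := by
        rw [mul_left_comm, mul_left_comm (v (z'.1 : B) ^ k)] at h
        exact mul_left_cancel₀ (pow_ne_zero (k * s) (D.val_ne D.x_ne)) h
      obtain ⟨h2, h3⟩ := eq_of_pow_mul_lattice_eq (fun i => div_ne_zero (D.val_ne (D.y_ne i))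
        (D.val_ne D.x_ne)) D.indep (D.val_ne (hA _ z.1.2).2) (D.val_ne (hA _ z'.1.2).2) hk hm
        (r := fun i => z.2 i) (r' := fun i => z'.2 i) (fun i => (z.2 i).2) (fun i => (z'.2 i).2) h'
      exact Prod.ext (Subtype.ext (hinj z.1.2 z'.1.2 h2))
        (funext fun i => Fin.ext (congrFun h3 i)))
    (by
      intro z u hu
      rw [mul_assoc, pow_add]
      exact Submodule.mul_mem_mul (Submodule.pow_mem_pow _ (hA _ z.1.2).1 _)
        (Submodule.mul_mem_mul (boxMonomial_mem D.mem_x D.mem_y k _) (hTV hu)))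
  simp only [Fintype.card_prod, Fintype.card_fun, Fintype.card_fin, Fintype.card_coe] at h1
  rw [hTf] at h1
  calc k ^ s * Module.finrank K S ≤ k ^ s * (f * A.card) := by gcongr
    _ = A.card * k ^ s * f := by ring
    _ ≤ _ := h1

end LatticeData

end BoxCount

/-! ### A valuation separating Laurent monomials -/

section LaurentMonomials

variable {K L : Type*} [Field K] [Field L] [Algebra K L] {s : ℕ} {z : Fin s → L}

/-- A finite relation multiplied by a high power of z_1 ⋯ z_s has nonnegative exponents only, where
independence of ordinary monomials applies. -/
theorem AlgebraicIndependent.linearIndependent_laurentMonomial (hz : AlgebraicIndependent K z) :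
    LinearIndependent K (fun a : Fin s → ℤ => ∏ i, z i ^ a i) := by
  classical
  have hz0 : ∀ i, z i ≠ 0 := fun i => hz.ne_zero i
  have hnat : LinearIndependent K (fun r : Fin s →₀ ℕ => ∏ i, z i ^ r i) := by
    have h1 := (MvPolynomial.basisMonomials (Fin s) K).linearIndependent.map'
      (MvPolynomial.aeval (R := K) z).toLinearMap (LinearMap.ker_eq_bot.2 hz)
    convert! h1 using 1
    funext r
    simp [MvPolynomial.aeval_monomial, Finsupp.prod_fintype]
  rw [linearIndependent_iff']
  intro t g hg a ha
  obtain ⟨N, hN⟩ : ∃ N : ℕ, ∀ a ∈ t, ∀ i, 0 ≤ (N : ℤ) + a i := by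
    refine ⟨∑ a ∈ t, ∑ i, (a i).natAbs, fun a ha i => ?_⟩
    have h1 : (a i).natAbs ≤ ∑ i, (a i).natAbs :=
      Finset.single_le_sum (f := fun i => (a i).natAbs) (fun _ _ => Nat.zero_le _)
        (Finset.mem_univ i)
    have h2 : ∑ i, (a i).natAbs ≤ ∑ a ∈ t, ∑ i, (a i).natAbs :=
      Finset.single_le_sum (f := fun a : Fin s → ℤ => ∑ i, (a i).natAbs)
        (fun _ _ => Nat.zero_le _) ha
    omega
  let e : (Fin s → ℤ) → (Fin s →₀ ℕ) := fun a =>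
    Finsupp.equivFunOnFinite.symm fun i => ((N : ℤ) + a i).toNat
  have he : Set.InjOn e t := by
    intro a ha b hb hab
    funext i
    have := DFunLike.congr_fun hab i
    simp only [e, Finsupp.equivFunOnFinite_symm_apply_apply] at this
    have h1 := hN a ha i
    have h2 := hN b hb i
    omega
  have hcomp : LinearIndepOn K (fun r : Fin s →₀ ℕ => ∏ i, z i ^ r i) (e '' t) :=
    hnat.linearIndepOn _
  have hcomp' := hcomp.comp_of_image he
  rw [linearIndepOn_finset_iff] at hcomp'
  refine hcomp' g ?_ a ha
  have : ∑ a ∈ t, g a • ∏ i, z i ^ (e a i) =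
      (∏ i, z i ^ (N : ℤ)) * ∑ a ∈ t, g a • ∏ i, z i ^ a i := by
    rw [Finset.mul_sum]
    refine Finset.sum_congr rfl fun a ha => ?_
    rw [mul_smul_comm, ← Finset.prod_mul_distrib]
    congr 1
    refine Finset.prod_congr rfl fun i _ => ?_
    rw [← zpow_add₀ (hz0 i), ← zpow_natCast]
    congr 1
    simp only [e, Finsupp.equivFunOnFinite_symm_apply_apply]
    exact Int.toNat_of_nonneg (hN a ha i)
  simp only [Function.comp_def]
  rw [this, hg, mul_zero]

/-- An algebraically independent family is multiplicatively independent for the values of a suitable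
valuation which is trivial on the base field. -/
theorem AlgebraicIndependent.exists_valuationSubring (hz : AlgebraicIndependent K z) :
    ∃ R : ValuationSubring L, (∀ c : K, c ≠ 0 → R.valuation (algebraMap K L c) = 1) ∧
      ∀ m : Fin s → ℤ, ∏ i, R.valuation (z i) ^ m i = 1 → m = 0 := by
  classical
  have hz0 : ∀ i, z i ≠ 0 := fun i => hz.ne_zero i
  let mon : (Fin s → ℤ) → L := fun a => ∏ i, z i ^ a i
  have hmon : LinearIndependent K mon := hz.linearIndependent_laurentMonomial
  have hmul : ∀ a b, mon a * mon b = mon (a + b) := fun a b => by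
    simp only [mon, ← Finset.prod_mul_distrib]
    exact Finset.prod_congr rfl fun i _ => (zpow_add₀ (hz0 i) _ _).symm
  -- The lexicographic order makes ℤ^s an ordered group. The lexicographically positive monomials
  -- span I, a proper ideal of A = K + I.
  let P : Set (Fin s → ℤ) := {a | 0 < toLex a}
  let I : Submodule K L := Submodule.span K (mon '' P)
  have hII : I * I ≤ I := by
    rw [Submodule.span_mul_span]
    refine Submodule.span_le.2 ?_
    rintro _ ⟨_, ⟨a, ha, rfl⟩, _, ⟨b, hb, rfl⟩, rfl⟩
    refine Submodule.subset_span ⟨a + b, ?_, (hmul a b).symm⟩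
    exact add_pos (α := Lex (Fin s → ℤ)) ha hb
  have h1I : (1 : L) ∉ I := by
    have : mon 0 = 1 := by simp [mon]
    rw [← this]
    exact hmon.notMem_span_image (lt_irrefl (0 : Lex (Fin s → ℤ)))
  have hone : (1 : L) ∈ (1 ⊔ I : Submodule K L) :=
    Submodule.mem_sup_left (Submodule.one_le.1 le_rfl)
  have hsup : (1 ⊔ I) * (1 ⊔ I) ≤ (1 ⊔ I : Submodule K L) := by
    rw [Submodule.sup_mul, Submodule.mul_sup, Submodule.mul_sup, one_mul, one_mul, mul_one]
    exact sup_le (sup_le le_sup_left le_sup_right) (sup_le le_sup_right (hII.trans le_sup_right))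
  have hAI : (1 ⊔ I) * I ≤ I := by
    rw [Submodule.sup_mul, one_mul]
    exact sup_le le_rfl hII
  let A : Subalgebra K L := (1 ⊔ I : Submodule K L).toSubalgebra hone
    (fun x y hx hy => hsup (Submodule.mul_mem_mul hx hy))
  let J : Ideal A.toSubring :=
    { carrier := {x | (x : L) ∈ I}
      add_mem' := fun ha hb => I.add_mem ha hb
      zero_mem' := I.zero_mem
      smul_mem' := fun c x hx => hAI (Submodule.mul_mem_mul c.2 hx) }
  -- Chevalley's extension: R contains A and its nonunits contain J. A nontrivial monomial or its
  -- inverse lies in J, so its value is not 1; constants and their inverses lie in R, so their value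
  -- is 1.
  obtain ⟨R, hAR, hJR⟩ := Ideal.image_subset_nonunits_valuationSubring J
    (fun h => h1I ((Ideal.eq_top_iff_one J).1 h))
  have hmonval : ∀ a, R.valuation (mon a) = ∏ i, R.valuation (z i) ^ a i := fun a => by
    simp [mon, map_prod, map_zpow₀]
  have hlt : ∀ a, 0 < toLex a → R.valuation (mon a) < 1 := fun a ha => by
    have hI : mon a ∈ I := Submodule.subset_span ⟨a, ha, rfl⟩
    exact R.mem_nonunits_iff.1 (hJR ⟨⟨mon a, Submodule.mem_sup_right hI⟩, hI, rfl⟩)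
  refine ⟨R, fun c hc => ?_, fun m hm => ?_⟩
  · have h : ∀ c : K, R.valuation (algebraMap K L c) ≤ 1 := fun c =>
      (R.valuation_le_one_iff _).2 (hAR (A.algebraMap_mem c))
    refine le_antisymm (h c) ?_
    have h2 := h c⁻¹
    rw [map_inv₀, map_inv₀] at h2
    exact (inv_le_one₀ (by
      rw [zero_lt_iff]
      simpa using hc)).1 h2
  · by_contra hne
    rcases lt_trichotomy (toLex m) 0 with h | h | h
    · have h1 := hlt (-m) (by
        have : toLex (-m) = -toLex m := rfl
        rw [this]
        exact neg_pos.2 h)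
      rw [hmonval] at h1
      simp only [Pi.neg_apply, zpow_neg, Finset.prod_inv_distrib] at h1
      rw [hm, inv_one] at h1
      exact lt_irrefl _ h1
    · exact hne h
    · have h1 := hlt m h
      rw [hmonval, hm] at h1
      exact lt_irrefl _ h1

end LaurentMonomials

/-! ### Polynomial growth of powers of a subspace -/

section Growth

variable {K L : Type*} [Field K] [Field L] [Algebra K L]

theorem Submodule.finrank_mul_le_mul {A : Type*} [CommRing A] [Algebra K A] (M N : Submodule K A)
    [FiniteDimensional K M] [FiniteDimensional K N] :
    Module.finrank K ↥(M * N) ≤ Module.finrank K M * Module.finrank K N := by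
  have h : (M * N) = LinearMap.range (Submodule.mulMap M N) := (Submodule.mulMap_range M N).symm
  rw [h, ← Module.finrank_tensorProduct]
  exact LinearMap.finrank_range_le _

theorem finrank_pow_span_le {s : ℕ} (z : Fin s → L) (N : ℕ) :
    Module.finrank K ↥((1 ⊔ Submodule.span K (Set.range z)) ^ N) ≤ (N + 1) ^ s := by
  classical
  let mon : (N : ℕ) → (Fin s → Fin (N + 1)) → L := fun N r => ∏ i, z i ^ (r i : ℕ)
  have key : ∀ N, (1 ⊔ Submodule.span K (Set.range z)) ^ N ≤
      Submodule.span K (Set.range (mon N)) := by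
    intro N
    induction N with
    | zero =>
      rw [pow_zero, Submodule.one_le]
      exact Submodule.subset_span ⟨0, by simp [mon]⟩
    | succ N ih =>
      rw [pow_succ']
      refine (mul_le_mul' le_rfl ih).trans ?_
      rw [Submodule.sup_mul, one_mul, Submodule.span_mul_span]
      refine sup_le (Submodule.span_le.2 ?_) (Submodule.span_le.2 ?_)
      · rintro _ ⟨r, rfl⟩
        exact Submodule.subset_span ⟨fun i => (r i).castSucc, by simp [mon]⟩
      · rintro _ ⟨_, ⟨j, rfl⟩, _, ⟨r, rfl⟩, rfl⟩
        refine Submodule.subset_span ⟨fun i => ⟨(r i : ℕ) + if i = j then 1 else 0, ?_⟩, ?_⟩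
        · have := (r i).2
          split_ifs <;> omega
        · simp only [mon, pow_add, Finset.prod_mul_distrib, pow_ite, pow_one, pow_zero]
          rw [Finset.prod_ite_eq' Finset.univ j z]
          simp [mul_comm]
  have : FiniteDimensional K (Submodule.span K (Set.range (mon N))) :=
    FiniteDimensional.span_of_finite K (Set.finite_range _)
  refine (Submodule.finrank_mono (key N)).trans ((finrank_range_le_card _).trans ?_)
  simp

open scoped Pointwise in
-- A common denominator a makes a·t integral over A = K[z], so A[a·t] is a finite A-module with
-- generators in a finite-dimensional Y. Each multiplication by a·t costs a bounded degree m in z,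
-- whence a^n (span t)^n ⊂ Z^(mn) Y, and Z^(mn) has dimension at most (mn+1)^s.
theorem exists_finrank_pow_le {s : ℕ} (z : Fin s → L) (t : Set L) (ht : t.Finite)
    (halg : ∀ w ∈ t, IsAlgebraic (Algebra.adjoin K (Set.range z)) w) :
    ∃ C : ℕ, ∀ n, Module.finrank K ↥(Submodule.span K t ^ n) ≤ C * (n + 1) ^ s := by
  classical
  set A := Algebra.adjoin K (Set.range z) with hA
  set Z : Submodule K L := 1 ⊔ Submodule.span K (Set.range z) with hZ
  have h1Z : (1 : Submodule K L) ≤ Z := le_sup_left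
  have hZmono : ∀ {m n : ℕ}, m ≤ n → Z ^ m ≤ Z ^ n := fun h => pow_le_pow_right' h1Z h
  have hL : ∀ {M N P : Submodule K L}, M ≤ N → M * P ≤ N * P := fun h => mul_le_mul' h le_rfl
  have hAZ : ∀ a ∈ A, ∃ m, a ∈ Z ^ m := by
    intro a ha
    induction ha using Algebra.adjoin_induction with
    | mem x hx =>
      exact ⟨1, by rw [pow_one]; exact Submodule.mem_sup_right (Submodule.subset_span hx)⟩
    | algebraMap r => exact ⟨0, by rw [pow_zero]; exact Submodule.mem_one.2 ⟨r, rfl⟩⟩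
    | add x y _ _ hx hy =>
      obtain ⟨m, hm⟩ := hx
      obtain ⟨n, hn⟩ := hy
      exact ⟨max m n, Submodule.add_mem _ (hZmono (le_max_left _ _) hm)
        (hZmono (le_max_right _ _) hn)⟩
    | mul x y _ _ hx hy =>
      obtain ⟨m, hm⟩ := hx
      obtain ⟨n, hn⟩ := hy
      exact ⟨m + n, by rw [pow_add]; exact Submodule.mul_mem_mul hm hn⟩
  obtain ⟨a, ha0, hint⟩ : ∃ a : A, a ≠ 0 ∧ ∀ w ∈ t, IsIntegral A (a • w) := by
    have h : ∀ w : L, ∃ r : A, r ≠ 0 ∧ (w ∈ t → IsIntegral A (r • w)) := by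
      intro w
      by_cases hw : w ∈ t
      · obtain ⟨r, hr, hr'⟩ := (halg w hw).exists_integral_multiple
        exact ⟨r, hr, fun _ => hr'⟩
      · exact ⟨1, one_ne_zero, fun h => absurd h hw⟩
    choose r hr0 hr using h
    refine ⟨∏ w ∈ ht.toFinset, r w, Finset.prod_ne_zero_iff.2 fun w _ => hr0 w, fun w hw => ?_⟩
    rw [← Finset.prod_erase_mul _ _ (ht.mem_toFinset.2 hw), mul_smul]
    exact (hr w hw).smul _
  have haL : (a : L) ≠ 0 := by simpa using ha0
  obtain ⟨Y₀, hY₀⟩ := fg_adjoin_of_finite (R := A) (s := (fun w => a • w) '' t) (ht.image _) (by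
    rintro _ ⟨w, hw, rfl⟩
    exact hint w hw)
  set R' := Algebra.adjoin A ((fun w => a • w) '' t) with hR'
  let Y : Submodule K L := Submodule.span K (insert 1 (Y₀ : Set L))
  have hYfd : FiniteDimensional K Y :=
    FiniteDimensional.span_of_finite K ((Finset.finite_toSet Y₀).insert 1)
  have h1Y : (1 : Submodule K L) ≤ Y :=
    Submodule.one_le.2 (Submodule.subset_span (Set.mem_insert _ _))
  have hYR : ∀ y ∈ insert 1 (Y₀ : Set L), y ∈ R' := by
    intro y hy
    rcases hy with rfl | hy
    · exact one_mem _
    · have : y ∈ Submodule.span A (Y₀ : Set L) := Submodule.subset_span hy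
      rw [hY₀] at this
      exact this
  have hRZ : ∀ x ∈ R', ∃ m, x ∈ Z ^ m * Y := by
    intro x hx
    have hx' : x ∈ Submodule.span A (Y₀ : Set L) := by rw [hY₀]; exact hx
    clear hx
    induction hx' using Submodule.span_induction with
    | mem y hy =>
      refine ⟨0, ?_⟩
      rw [pow_zero, one_mul]
      exact Submodule.subset_span (Set.mem_insert_of_mem _ hy)
    | zero => exact ⟨0, zero_mem _⟩
    | add x y _ _ hx hy =>
      obtain ⟨m, hm⟩ := hx
      obtain ⟨n, hn⟩ := hy
      exact ⟨max m n, Submodule.add_mem _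
        (hL (hZmono (le_max_left _ _)) hm)
        (hL (hZmono (le_max_right _ _)) hn)⟩
    | smul c x _ hx =>
      obtain ⟨m, hm⟩ := hx
      obtain ⟨n, hn⟩ := hAZ c c.2
      refine ⟨n + m, ?_⟩
      rw [pow_add, mul_assoc]
      exact Submodule.mul_mem_mul hn hm
  set W := Submodule.span K t with hW
  set U : Submodule K L := Submodule.span K {(a : L)} * W with hU
  obtain ⟨m, hm⟩ : ∃ m, U * Y ≤ Z ^ m * Y := by
    have hUY : U * Y = Submodule.span K ((({(a : L)} : Set L) * t) * insert 1 (Y₀ : Set L)) := by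
      rw [hU, hW, Submodule.span_mul_span, Submodule.span_mul_span]
    have hfin : ((({(a : L)} : Set L) * t) * insert 1 (Y₀ : Set L)).Finite :=
      ((Set.finite_singleton _).mul ht).mul ((Finset.finite_toSet Y₀).insert 1)
    have h : ∀ x : L, ∃ m, x ∈ (({(a : L)} : Set L) * t) * insert 1 (Y₀ : Set L) → x ∈ Z ^ m * Y := by
      intro x
      by_cases hx : x ∈ (({(a : L)} : Set L) * t) * insert 1 (Y₀ : Set L)
      · obtain ⟨_, ⟨_, ha', w, hw, rfl⟩, y, hy, rfl⟩ := hx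
        rw [Set.mem_singleton_iff] at ha'
        subst ha'
        obtain ⟨m, hm⟩ := hRZ (a * w * y) (mul_mem
          (Algebra.subset_adjoin ⟨w, hw, rfl⟩) (hYR y hy))
        exact ⟨m, fun _ => hm⟩
      · exact ⟨0, fun h => absurd h hx⟩
    choose m hm using h
    refine ⟨hfin.toFinset.sup m, ?_⟩
    rw [hUY, Submodule.span_le]
    intro x hx
    exact hL (hZmono (Finset.le_sup (hfin.mem_toFinset.2 hx))) (hm x hx)
  have hUn : ∀ n, U ^ n * Y ≤ Z ^ (m * n) * Y := by
    intro n
    induction n with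
    | zero => simp
    | succ n ih =>
      rw [pow_succ, mul_assoc]
      refine (mul_le_mul' le_rfl hm).trans ?_
      rw [mul_left_comm]
      refine (mul_le_mul' le_rfl ih).trans ?_
      rw [← mul_assoc, ← pow_add, mul_add, mul_one, add_comm]
  have hZfd : ∀ n, FiniteDimensional K ↥(Z ^ n) := by
    intro n
    have hfg : Z.FG := by
      refine Submodule.FG.sup ?_ (Submodule.fg_span (Set.finite_range z))
      rw [Submodule.one_eq_span]
      exact Submodule.fg_span_singleton _
    exact Module.Finite.iff_fg.2 (hfg.pow n)
  refine ⟨(m + 1) ^ s * Module.finrank K Y, fun n => ?_⟩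
  have hfd : FiniteDimensional K ↥(Z ^ (m * n) * Y) :=
    Module.Finite.iff_fg.2 ((Module.Finite.iff_fg.1 (hZfd _)).mul (Module.Finite.iff_fg.1 hYfd))
  have hmem : ∀ w ∈ W ^ n, (a : L) ^ n * w ∈ Z ^ (m * n) * Y := by
    intro w hw
    refine hUn n ?_
    rw [← mul_one ((a : L) ^ n * w)]
    refine Submodule.mul_mem_mul ?_ (h1Y (Submodule.one_le.1 le_rfl))
    rw [hU, mul_pow]
    exact Submodule.mul_mem_mul (Submodule.pow_mem_pow _ (Submodule.mem_span_singleton_self _) _) hw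
  have hle : Module.finrank K ↥(W ^ n) ≤ Module.finrank K ↥(Z ^ (m * n) * Y) := by
    let F : ↥(W ^ n) →ₗ[K] ↥(Z ^ (m * n) * Y) :=
      (LinearMap.mulLeft K ((a : L) ^ n)).restrict hmem
    refine LinearMap.finrank_le_finrank_of_injective (f := F) fun x y hxy => ?_
    have := congrArg Subtype.val hxy
    change (a : L) ^ n * x = (a : L) ^ n * y at this
    exact Subtype.ext (mul_left_cancel₀ (pow_ne_zero _ haL) this)
  have := hZfd (m * n)
  calc Module.finrank K ↥(W ^ n) ≤ Module.finrank K ↥(Z ^ (m * n)) * Module.finrank K Y :=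
        hle.trans (Submodule.finrank_mul_le_mul _ _)
    _ ≤ (m * n + 1) ^ s * Module.finrank K Y := by
        gcongr
        exact finrank_pow_span_le z _
    _ ≤ ((m + 1) * (n + 1)) ^ s * Module.finrank K Y := by gcongr; nlinarith
    _ = _ := by rw [mul_pow]; ring

end Growth

/-! ### Existence of the valuation and of the independent values -/

section Existence

variable {K B : Type*} [Field K] [CommRing B] [IsDomain B] [Algebra K B]

/-- A transcendence basis z is extracted from generators of V divided by x₀. Its members have the
form y_i/x₀ with y_i in V, and its size s is both the number of independent values and the exponent
of growth. -/
theorem exists_latticeData (V : Submodule K B) [FiniteDimensional K V] {x₀ : B} (hx : x₀ ∈ V)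
    (hx0 : x₀ ≠ 0) :
    ∃ (s : ℕ) (C : ℕ) (y : Fin s → B) (R : ValuationSubring (FractionRing B)),
      LatticeData (R.valuation.comap (algebraMap B (FractionRing B))) V s x₀ y C := by
  classical
  set L := FractionRing B
  have hinj : Function.Injective (algebraMap B L) := IsFractionRing.injective B L
  have hxL : algebraMap B L x₀ ≠ 0 := by simpa using hx0
  obtain ⟨G, hG⟩ := Module.Finite.iff_fg.1 ‹FiniteDimensional K V›
  let q : B → L := fun b => algebraMap B L b / algebraMap B L x₀
  set t : Set L := q '' (G : Set B) with ht
  have htfin : t.Finite := (Finset.finite_toSet G).image q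
  obtain ⟨I, hI⟩ := (AlgebraicIndependent.matroid K L).exists_isBasis t
  rw [AlgebraicIndependent.matroid_isBasis_iff] at hI
  obtain ⟨hIind, hIt, hIalg⟩ := hI
  have hIfin : I.Finite := htfin.subset hIt
  have := hIfin.fintype
  let e : Fin (Fintype.card I) ≃ I := (Fintype.equivFin I).symm
  set s := Fintype.card I
  let z : Fin s → L := fun i => e i
  have hz : AlgebraicIndependent K z := hIind.comp e e.injective
  have hrange : Set.range z = I := by
    have : z = Subtype.val ∘ e := rfl
    rw [this, Set.range_comp, e.range_eq_univ, Set.image_univ, Subtype.range_coe]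
  have hy : ∀ i, ∃ b ∈ V, q b = z i := by
    intro i
    obtain ⟨b, hb, hbz⟩ := hIt (e i).2
    exact ⟨b, hG ▸ Submodule.subset_span hb, hbz⟩
  choose y hyV hyz using hy
  obtain ⟨R, hRK, hRz⟩ := hz.exists_valuationSubring
  obtain ⟨C, hC⟩ := exists_finrank_pow_le z t htfin (by rw [hrange]; exact hIalg)
  have hqV : ∀ b ∈ V, q b ∈ Submodule.span K t := by
    intro b hb
    let φ : B →ₗ[K] L :=
      (LinearMap.mulRight K (algebraMap B L x₀)⁻¹).comp (Algebra.linearMap B L |>.restrictScalars K)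
    have hφ : ∀ b, φ b = q b := fun b => by simp [φ, q, div_eq_mul_inv]
    have h1 : φ b ∈ (Submodule.span K (G : Set B)).map φ := ⟨b, by rw [hG]; exact hb, rfl⟩
    rw [Submodule.map_span] at h1
    have h2 : φ '' (G : Set B) = t := by
      rw [ht]
      exact Set.image_congr fun b _ => hφ b
    rwa [h2, hφ] at h1
  have hpow : ∀ n, ∀ b ∈ V ^ n,
      algebraMap B L b * (algebraMap B L x₀)⁻¹ ^ n ∈ Submodule.span K t ^ n := by
    intro n
    induction n with
    | zero =>
      intro b hb
      rw [pow_zero] at hb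
      obtain ⟨c, rfl⟩ := Submodule.mem_one.1 hb
      rw [pow_zero, pow_zero, mul_one]
      exact Submodule.mem_one.2 ⟨c, IsScalarTower.algebraMap_apply K B L c⟩
    | succ n ih =>
      intro b hb
      rw [pow_succ] at hb
      induction hb using Submodule.mul_induction_on' with
      | mem_mul_mem a ha c hc =>
        have := Submodule.mul_mem_mul (ih a ha) (hqV c hc)
        rw [pow_succ (Submodule.span K t)]
        convert! this using 1
        simp only [q, map_mul, pow_succ, div_eq_mul_inv]
        ring
      | add a _ c _ ha hc =>
        rw [map_add, add_mul]
        exact Submodule.add_mem _ ha hc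
  have hgrowth : ∀ n, Module.finrank K ↥(V ^ n) ≤ C * (n + 1) ^ s := by
    intro n
    refine le_trans ?_ (hC n)
    have : FiniteDimensional K ↥(Submodule.span K t ^ n) :=
      Module.Finite.iff_fg.2 ((Submodule.fg_span htfin).pow n)
    let F : ↥(V ^ n) →ₗ[K] ↥(Submodule.span K t ^ n) :=
      { toFun := fun b => ⟨_, hpow n b b.2⟩
        map_add' := fun a b => Subtype.ext (by simp [add_mul])
        map_smul' := fun c b => Subtype.ext (by simp [Algebra.smul_def,
          IsScalarTower.algebraMap_apply K B L, mul_assoc]) }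
    refine LinearMap.finrank_le_finrank_of_injective (f := F) fun a b hab => ?_
    have := congrArg Subtype.val hab
    exact Subtype.ext (hinj (mul_right_cancel₀ (pow_ne_zero _ (inv_ne_zero hxL)) this))
  refine ⟨s, C, y, R, ?_⟩
  refine ⟨fun b hb => ?_, fun c hc => ?_, hx, hx0, hyV, fun i h => ?_, fun m hm => ?_, hgrowth⟩
  · simpa using hb
  · rw [Valuation.comap_apply, ← IsScalarTower.algebraMap_apply]
    exact hRK c hc
  · have := hyz i
    rw [h] at this
    simp only [q, map_zero, zero_div] at this
    exact hz.ne_zero i this.symm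
  · apply hRz
    simp only [Valuation.comap_apply, ← map_div₀] at hm
    simpa only [← hyz] using hm

end Existence

/-! ### Homogeneous pieces as powers of the first one -/

section Graded

variable {K B : Type*} [Field K] [CommRing B] [Algebra K B]
  (𝓑 : ℕ → Submodule K B) [GradedAlgebra 𝓑]

theorem gradedPiece_one_pow_le (n : ℕ) : 𝓑 1 ^ n ≤ 𝓑 n := by
  induction n with
  | zero =>
    rw [pow_zero, Submodule.one_le]
    exact SetLike.GradedOne.one_mem
  | succ n ih =>
    rw [pow_succ]
    exact Submodule.mul_le.2 fun a ha b hb => SetLike.mul_mem_graded (ih ha) hb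

theorem gradedPiece_eq_pow (hgen : Algebra.adjoin K (𝓑 1 : Set B) = ⊤) (n : ℕ) :
    𝓑 n = 𝓑 1 ^ n := by
  classical
  refine le_antisymm (fun b hb => ?_) (gradedPiece_one_pow_le 𝓑 n)
  have key : ∀ b ∈ Submodule.span K (Submonoid.closure (𝓑 1 : Set B) : Set B),
      (DirectSum.decompose 𝓑 b n : B) ∈ 𝓑 1 ^ n := by
    intro b hb
    induction hb using Submodule.span_induction with
    | mem x hx =>
      obtain ⟨k, hk⟩ : ∃ k, x ∈ 𝓑 1 ^ k := by
        induction hx using Submonoid.closure_induction with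
        | mem x hx => exact ⟨1, by rwa [pow_one]⟩
        | one => exact ⟨0, by rw [pow_zero]; exact Submodule.one_le.1 le_rfl⟩
        | mul x y _ _ hx hy =>
          obtain ⟨k, hk⟩ := hx
          obtain ⟨l, hl⟩ := hy
          exact ⟨k + l, by rw [pow_add]; exact Submodule.mul_mem_mul hk hl⟩
      by_cases hkn : k = n
      · subst hkn
        rwa [DirectSum.decompose_of_mem_same 𝓑 (gradedPiece_one_pow_le 𝓑 k hk)]
      · rw [DirectSum.decompose_of_mem_ne 𝓑 (gradedPiece_one_pow_le 𝓑 k hk) hkn]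
        exact zero_mem _
    | zero => simp
    | add x y _ _ hx hy =>
      rw [DirectSum.decompose_add, DirectSum.add_apply, Submodule.coe_add]
      exact add_mem hx hy
    | smul c x _ hx =>
      rw [DirectSum.decompose_smul]
      exact Submodule.smul_mem _ c hx
  have htop : b ∈ Submodule.span K (Submonoid.closure (𝓑 1 : Set B) : Set B) := by
    rw [← Algebra.adjoin_eq_span, hgen]
    exact (Algebra.mem_top : b ∈ (⊤ : Subalgebra K B))
  have := key b htop
  rwa [DirectSum.decompose_of_mem_same 𝓑 hb] at this

end Graded

/-! ### Filtration steps and products -/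

namespace RFiltration

variable {K W : Type*} [Field K] [AddCommGroup W] [Module K W] [FiniteDimensional K W]

/-- The rank is integer valued, so left continuity makes it constant just to the left of t. -/
theorem exists_lt_sub_eq (F : RFiltration K W) (t : ℝ) : ∃ s < t, F.sub s = F.sub t := by
  have h := F.left_cont t
  have h1 : ∀ᶠ s in 𝓝[Set.Iic t] t,
      (Module.finrank K (F.sub s) : ℝ) < Module.finrank K (F.sub t) + 1 :=
    h.eventually (eventually_lt_nhds (lt_add_one _))
  have h2 : ∀ᶠ s in 𝓝[Set.Iio t] t,
      (Module.finrank K (F.sub s) : ℝ) < Module.finrank K (F.sub t) + 1 :=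
    h1.filter_mono (nhdsWithin_mono _ Set.Iio_subset_Iic_self)
  obtain ⟨s, hs, hst⟩ := (h2.and self_mem_nhdsWithin).exists
  refine ⟨s, hst, ?_⟩
  have hle := F.antitone_sub (le_of_lt (show s < t from hst))
  refine (Submodule.eq_of_le_of_finrank_le hle ?_).symm
  have : Module.finrank K (F.sub s) < Module.finrank K (F.sub t) + 1 := by exact_mod_cast hs
  omega

/-- By left continuity the supremum defining `lam` is attained when it is finite. -/
theorem coe_le_lam_iff (F : RFiltration K W) {x : W} {c : ℝ} :
    (c : EReal) ≤ F.lam x ↔ x ∈ F.sub c := by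
  constructor
  · intro h
    obtain ⟨s, hs, hsc⟩ := F.exists_lt_sub_eq c
    have h1 : (s : EReal) < F.lam x := lt_of_lt_of_le (EReal.coe_lt_coe_iff.2 hs) h
    obtain ⟨_, ⟨a, ha, rfl⟩, hsa⟩ := lt_sSup_iff.1 h1
    rw [← hsc]
    exact F.antitone_sub (EReal.coe_lt_coe_iff.1 hsa).le ha
  · intro h
    exact le_sSup ⟨c, h, rfl⟩

end RFiltration

theorem Submodule.finProd_le {K B : Type*} [CommSemiring K] [CommSemiring B] [Algebra K B] {l : ℕ}
    (T : Fin l → Submodule K B) (W : Submodule K B)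
    (h : ∀ x : Fin l → B, (∀ i, x i ∈ T i) → ∏ i, x i ∈ W) : ∏ i, T i ≤ W := by
  induction l generalizing W with
  | zero => simpa [Submodule.one_le] using h (fun _ => 1) (fun i => i.elim0)
  | succ l ih =>
    rw [Fin.prod_univ_succ, Submodule.mul_le]
    intro m hm n hn
    refine ih (fun i => T i.succ) (W.comap (LinearMap.mulLeft K m)) (fun x hx => ?_) hn
    have := h (Fin.cons m x) (fun i => by
      refine Fin.cases ?_ (fun i => ?_) i
      · simpa using hm
      · simpa using hx i)
    simpa [Fin.prod_univ_succ] using this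

section FiltPiece

variable {K B : Type*} [Field K] [CommRing B] [Algebra K B]
  {𝓑 : ℕ → Submodule K B} [∀ n, FiniteDimensional K (𝓑 n)]

/-- The filtration step `F_t B_n`, as a subspace of `B`. -/
def filtPiece (F : ∀ n, RFiltration K (𝓑 n)) (n : ℕ) (t : ℝ) : Submodule K B :=
  ((F n).sub t).map (𝓑 n).subtype

theorem filtPiece_le (F : ∀ n, RFiltration K (𝓑 n)) (n : ℕ) (t : ℝ) : filtPiece F n t ≤ 𝓑 n :=
  Submodule.map_subtype_le _ _

theorem filtPiece_mono (F : ∀ n, RFiltration K (𝓑 n)) (n : ℕ) {t u : ℝ} (h : t ≤ u) :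
    filtPiece F n u ≤ filtPiece F n t :=
  Submodule.map_mono ((F n).antitone_sub h)

theorem finrank_filtPiece (F : ∀ n, RFiltration K (𝓑 n)) (n : ℕ) (t : ℝ) :
    Module.finrank K (filtPiece F n t) = Module.finrank K ((F n).sub t) :=
  Submodule.finrank_map_subtype_eq _ _

instance finiteDimensional_filtPiece (F : ∀ n, RFiltration K (𝓑 n)) (n : ℕ) (t : ℝ) :
    FiniteDimensional K (filtPiece F n t) :=
  Submodule.finiteDimensional_of_le (filtPiece_le F n t)

theorem filtPiece_eq_iff (F : ∀ n, RFiltration K (𝓑 n)) (n : ℕ) (t : ℝ) :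
    filtPiece F n t = 𝓑 n ↔ (F n).sub t = ⊤ := by
  constructor
  · intro h
    rw [eq_top_iff]
    intro x _
    have : (x : B) ∈ filtPiece F n t := by rw [h]; exact x.2
    obtain ⟨y, hy, hyx⟩ := this
    rwa [← Subtype.ext (a1 := y) (a2 := x) hyx]
  · intro h
    rw [filtPiece, h, Submodule.map_top, Submodule.range_subtype]

theorem exists_filtPiece_eq (F : ∀ n, RFiltration K (𝓑 n)) (n : ℕ) :
    ∃ t, filtPiece F n t = 𝓑 n := by
  obtain ⟨t, ht⟩ := (F n).eventually_top.exists
  exact ⟨t, (filtPiece_eq_iff F n t).2 ht⟩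

variable [GradedAlgebra 𝓑]

theorem QuasiFilteredFrom.prod_mem {f : ℕ → ℝ} {n₀ : ℕ} {F : ∀ n, RFiltration K (𝓑 n)}
    (hF : QuasiFilteredFrom 𝓑 f n₀ F) {l : ℕ} (hl : 2 ≤ l) (n : Fin l → ℕ) (hn : ∀ i, n₀ ≤ n i)
    (t : Fin l → ℝ) (x : Fin l → B) (hx : ∀ i, x i ∈ filtPiece F (n i) (t i)) :
    ∏ i, x i ∈ filtPiece F (∑ i, n i) (∑ i, (t i - f (n i))) := by
  choose y hy hyx using hx
  have hmem : ∏ i, x i ∈ 𝓑 (∑ i, n i) :=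
    SetLike.prod_mem_graded 𝓑 _ _ fun i _ => by rw [← hyx i]; exact (y i).2
  refine ⟨⟨_, hmem⟩, ?_, rfl⟩
  have hprod : ∏ i, x i = ∏ i, (y i : B) := Finset.prod_congr rfl fun i _ => (hyx i).symm
  have h := hF l hl n hn y ⟨_, hmem⟩ hprod
  refine (F _).coe_le_lam_iff.1 (le_trans ?_ h)
  have hcoe : ((∑ i, (t i - f (n i)) : ℝ) : EReal) = ∑ i, ((t i : EReal) - (f (n i) : EReal)) := by
    simp only [← EReal.coe_sub]
    exact map_sum (⟨⟨fun r : ℝ => (r : EReal), EReal.coe_zero⟩, EReal.coe_add⟩ : ℝ →+ EReal) _ _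
  rw [hcoe]
  refine Finset.sum_le_sum fun i _ => EReal.sub_le_sub ?_ le_rfl
  exact (F _).coe_le_lam_iff.2 (hy i)

/-- The inequality is applied to all k + M factors at once, so f is charged only at the degrees p
and q. Iterated products of two would also charge it at every intermediate degree. -/
theorem QuasiFilteredFrom.pow_mul_pow_le {f : ℕ → ℝ} {n₀ : ℕ} {F : ∀ n, RFiltration K (𝓑 n)}
    (hF : QuasiFilteredFrom 𝓑 f n₀ F) {p q k M N : ℕ} (hp : n₀ ≤ p) (hq : n₀ ≤ q)
    (hkM : 2 ≤ k + M) (hN : N = k * p + M * q) (t u : ℝ) :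
    filtPiece F p t ^ k * filtPiece F q u ^ M ≤
      filtPiece F N (k * (t - f p) + M * (u - f q)) := by
  let n : Fin (k + M) → ℕ := Fin.append (fun _ : Fin k => p) (fun _ : Fin M => q)
  let τ : Fin (k + M) → ℝ := Fin.append (fun _ : Fin k => t) (fun _ : Fin M => u)
  have h := Submodule.finProd_le (fun i => filtPiece F (n i) (τ i)) _
    (hF.prod_mem hkM n (fun i => by
      refine Fin.addCases (fun i => ?_) (fun i => ?_) i
      · simpa [n] using hp
      · simpa [n] using hq) τ)
  simp only [Fin.prod_univ_add, Fin.sum_univ_add, n, τ, Fin.append_left, Fin.append_right,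
    Finset.prod_const, Finset.sum_const, Finset.card_univ, Fintype.card_fin, smul_eq_mul,
    nsmul_eq_mul] at h
  rw [hN]
  exact h

end FiltPiece

/-! ### Asymptotic dimension -/

/-- The growth inequality yields bounds only along a progression of step E P. The remainder ρ
reaches every large n, and 1 + E j is n/P up to a bounded error. The floor ρ₀ on ρ leaves room for
the degree condition n₀. -/
theorem eventually_le_of_arithmetic_lower_bound {u : ℕ → ℝ} {N₀ ρ₀ E P s : ℕ} {σ c : ℝ}
    (hE : 0 < E) (hP : 0 < P) (hσ : 0 ≤ σ)
    (h : ∀ᶠ n in atTop, ∀ j ρ, ρ₀ ≤ ρ → ρ < ρ₀ + E * P → n = N₀ + j * (E * P) + ρ →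
      ((1 + E * j : ℕ) : ℝ) ^ s * σ ≤ u n)
    (hc : c < σ / (P : ℝ) ^ s) : ∀ᶠ n : ℕ in atTop, c * (n : ℝ) ^ s ≤ u n := by
  set A : ℝ := N₀ + ρ₀ + E * P with hA
  have hlim : Tendsto (fun n : ℕ => σ * ((1 - A / n) / P) ^ s) atTop (𝓝 (σ * ((1 - 0) / P) ^ s)) :=
    ((((tendsto_const_div_atTop_nhds_zero_nat A).const_sub 1).div_const (P : ℝ)).pow s).const_mul σ
  have hc' : c < σ * ((1 - 0) / P : ℝ) ^ s := by
    rwa [sub_zero, one_div, inv_pow, ← div_eq_mul_inv]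
  filter_upwards [h, hlim.eventually (lt_mem_nhds hc'), eventually_ge_atTop (N₀ + ρ₀ + E * P + 1)]
    with n hn hcn hnge
  have hΔ : 0 < E * P := Nat.mul_pos hE hP
  set j := (n - N₀ - ρ₀) / (E * P) with hj
  have hdm := Nat.div_add_mod (n - N₀ - ρ₀) (E * P)
  have hmod := Nat.mod_lt (n - N₀ - ρ₀) hΔ
  rw [← hj] at hdm
  have h1 := hn j (ρ₀ + (n - N₀ - ρ₀) % (E * P)) (by omega) (by omega) (by
    rw [mul_comm j]; omega)
  have hn0 : (0 : ℝ) < n := by exact_mod_cast (by omega : 0 < n)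
  have hP0 : (0 : ℝ) < P := by exact_mod_cast hP
  have hjn : (n : ℝ) - A ≤ P * ((1 + E * j : ℕ) : ℝ) := by
    have : n ≤ N₀ + ρ₀ + E * P + P * (1 + E * j) := by
      have : P * (1 + E * j) = P + E * P * j := by ring
      omega
    have : (n : ℝ) ≤ N₀ + ρ₀ + E * P + P * ((1 + E * j : ℕ) : ℝ) := by exact_mod_cast this
    linarith
  have hnA : 0 ≤ (n : ℝ) - A := by
    have : ((N₀ + ρ₀ + E * P + 1 : ℕ) : ℝ) ≤ n := by exact_mod_cast hnge
    push_cast at this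
    linarith
  refine le_trans ?_ h1
  calc c * (n : ℝ) ^ s ≤ σ * ((1 - A / n) / P) ^ s * (n : ℝ) ^ s := by gcongr
    _ = σ * (((n : ℝ) - A) / P) ^ s := by
        rw [mul_assoc, ← mul_pow]
        congr 2
        field_simp
    _ ≤ σ * ((1 + E * j : ℕ) : ℝ) ^ s := by
        gcongr
        rw [div_le_iff₀ hP0]
        linarith
    _ = _ := mul_comm _ _

section Dimension

variable {K B : Type*} [Field K] [CommRing B] [IsDomain B] [Algebra K B]

theorem finrank_le_of_mul_mem {M N : Submodule K B} [FiniteDimensional K N] {x : B} (hx : x ≠ 0)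
    (h : ∀ m ∈ M, x * m ∈ N) : Module.finrank K M ≤ Module.finrank K N := by
  let F : M →ₗ[K] N := (LinearMap.mulLeft K x).restrict h
  refine LinearMap.finrank_le_finrank_of_injective (f := F) fun a b hab => ?_
  have h1 : x * (a : B) = x * (b : B) := congrArg Subtype.val hab
  exact Subtype.ext (mul_left_cancel₀ hx h1)

/-- A growth property of the powers of a subspace `V`: products of `k` elements of a subspace of
`V ^ p` fill up, up to a shift, a box of volume `k ^ s`. -/
def BoxGrowth (V : Submodule K B) (s n₁ : ℕ) : Prop :=
  ∀ (p : ℕ) (S : Submodule K B), S ≤ V ^ p → ∃ E : ℕ, 0 < E ∧ ∀ j k : ℕ, k = 1 + E * j →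
    k ^ s * Module.finrank K S ≤ Module.finrank K ↥(S ^ k * V ^ (k * s + n₁))

omit [IsDomain B] in
theorem fd_pow (V : Submodule K B) [FiniteDimensional K V] (n : ℕ) : FiniteDimensional K ↥(V ^ n) :=
  Module.Finite.iff_fg.2 ((Module.Finite.iff_fg.1 ‹_›).pow n)

theorem finrank_pow_mono {V : Submodule K B} [FiniteDimensional K V] {x₀ : B} (hx : x₀ ∈ V)
    (hx0 : x₀ ≠ 0) : Monotone fun n => Module.finrank K ↥(V ^ n) := by
  refine monotone_nat_of_le_succ fun n => ?_
  have := fd_pow V (n + 1)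
  refine finrank_le_of_mul_mem hx0 fun m hm => ?_
  rw [pow_succ']
  exact Submodule.mul_mem_mul hx hm

theorem BoxGrowth.eventually_le_finrank {V : Submodule K B} [FiniteDimensional K V] {x₀ : B}
    (hx : x₀ ∈ V) (hx0 : x₀ ≠ 0) {s n₁ : ℕ} (hV : BoxGrowth V s n₁) {p : ℕ} (hp : 0 < p) {c : ℝ}
    (hc : c < (Module.finrank K ↥(V ^ p) : ℝ) / ((p + s : ℕ) : ℝ) ^ s) :
    ∀ᶠ n : ℕ in atTop, c * (n : ℝ) ^ s ≤ (Module.finrank K ↥(V ^ n) : ℝ) := by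
  obtain ⟨E, hE, hk⟩ := hV p (V ^ p) le_rfl
  refine eventually_le_of_arithmetic_lower_bound (u := fun n => (Module.finrank K ↥(V ^ n) : ℝ))
    (N₀ := p + s + n₁) (ρ₀ := 0) hE (by omega : 0 < p + s) (Nat.cast_nonneg _)
    (Eventually.of_forall ?_) hc
  intro n j ρ _ _ hn
  have h1 := hk j (1 + E * j) rfl
  rw [← pow_mul, ← pow_add] at h1
  have h2 : p * (1 + E * j) + ((1 + E * j) * s + n₁) ≤ n := by
    rw [hn]
    have : p * (1 + E * j) + ((1 + E * j) * s + n₁) = p + s + n₁ + j * (E * (p + s)) := by ring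
    omega
  exact_mod_cast h1.trans (finrank_pow_mono hx hx0 h2)

/-- A Fekete argument: each level p bounds the liminf of dim V^n / n^s below by dim V^p / (p+s)^s,
so the limit exists and is the supremum of these quotients over p ≥ 1. -/
theorem BoxGrowth.exists_tendsto {V : Submodule K B} [FiniteDimensional K V] {x₀ : B}
    (hx : x₀ ∈ V) (hx0 : x₀ ≠ 0) {s n₁ C : ℕ} (hV : BoxGrowth V s n₁)
    (hC : ∀ n, Module.finrank K ↥(V ^ n) ≤ C * (n + 1) ^ s) :
    ∃ ℓ : ℝ, 0 < ℓ ∧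
      Tendsto (fun n : ℕ => (Module.finrank K ↥(V ^ n) : ℝ) / (n : ℝ) ^ s) atTop (𝓝 ℓ) ∧
      Tendsto (fun n : ℕ => (Module.finrank K ↥(V ^ n) : ℝ) / ((n + s : ℕ) : ℝ) ^ s) atTop
        (𝓝 ℓ) := by
  set h : ℕ → ℝ := fun n => (Module.finrank K ↥(V ^ n) : ℝ) with hh
  have hpos : ∀ n, 0 < h n := fun n => by
    have := fd_pow V n
    have : 0 < Module.finrank K ↥(V ^ n) := Module.finrank_pos_iff_exists_ne_zero.2
      ⟨⟨x₀ ^ n, Submodule.pow_mem_pow _ hx n⟩, fun h => pow_ne_zero n hx0 (congrArg Subtype.val h)⟩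
    exact Nat.cast_pos.2 this
  -- The shift of index keeps the level positive, as `BoxGrowth.eventually_le_finrank` requires.
  let w : ℕ → ℝ := fun n => h (n + 1) / ((n + 1 + s : ℕ) : ℝ) ^ s
  have hw : BddAbove (Set.range w) := by
    refine ⟨C * 2 ^ s, ?_⟩
    rintro _ ⟨n, rfl⟩
    have h0 : (0 : ℝ) < ((n + 1 + s : ℕ) : ℝ) ^ s := by
      rw [← Nat.cast_pow]
      exact_mod_cast Nat.pow_pos (by omega)
    simp only [w]
    rw [div_le_iff₀ h0]
    have h1 : h (n + 1) ≤ C * ((n + 1 + 1 : ℕ) : ℝ) ^ s := by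
      rw [← Nat.cast_pow, ← Nat.cast_mul]
      exact Nat.cast_le.2 (hC (n + 1))
    refine h1.trans ?_
    rw [mul_assoc, ← mul_pow]
    gcongr
    have : n + 1 + 1 ≤ 2 * (n + 1 + s) := by omega
    exact_mod_cast this
  set ℓ := ⨆ n, w n with hℓ
  have hw0 : 0 < w 0 := div_pos (hpos _) (by
    rw [← Nat.cast_pow]
    exact_mod_cast Nat.pow_pos (by omega))
  have hℓ0 : 0 < ℓ := lt_of_lt_of_le hw0 (le_ciSup hw 0)
  have hratio : Tendsto (fun n : ℕ => (((n + s : ℕ) : ℝ) / n) ^ s) atTop (𝓝 1) := by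
    have h1 : Tendsto (fun n : ℕ => (1 + (s : ℝ) / n) ^ s) atTop (𝓝 ((1 + 0) ^ s)) :=
      ((tendsto_const_div_atTop_nhds_zero_nat (s : ℝ)).const_add 1).pow s
    rw [add_zero, one_pow] at h1
    refine h1.congr' ?_
    filter_upwards [eventually_gt_atTop 0] with n hn
    have : (0 : ℝ) < n := by exact_mod_cast hn
    congr 1
    push_cast
    field_simp
  have hlim : Tendsto (fun n : ℕ => h n / (n : ℝ) ^ s) atTop (𝓝 ℓ) := by
    rw [tendsto_order]
    constructor
    · intro c hc
      obtain ⟨c', hcc', hc'⟩ := exists_between hc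
      obtain ⟨n, hn⟩ := exists_lt_of_lt_ciSup hc'
      filter_upwards [hV.eventually_le_finrank hx hx0 (Nat.succ_pos n) hn,
        eventually_gt_atTop 0] with m hm hm0
      have : (0 : ℝ) < (m : ℝ) ^ s := pow_pos (by exact_mod_cast hm0) _
      refine lt_of_lt_of_le hcc' ?_
      rw [le_div_iff₀ this]
      exact hm
    · intro c hc
      have h1 : Tendsto (fun n : ℕ => ℓ * (((n + s : ℕ) : ℝ) / n) ^ s) atTop (𝓝 (ℓ * 1)) :=
        hratio.const_mul ℓ
      rw [mul_one] at h1
      filter_upwards [h1.eventually (gt_mem_nhds hc), eventually_gt_atTop 0] with n hn hn0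
      refine lt_of_le_of_lt ?_ hn
      have hn1 : (0 : ℝ) < n := by exact_mod_cast hn0
      have hns : (0 : ℝ) < ((n + s : ℕ) : ℝ) := by exact_mod_cast (by omega : 0 < n + s)
      obtain ⟨m, rfl⟩ : ∃ m, n = m + 1 := ⟨n - 1, by omega⟩
      have h2 : w m ≤ ℓ := le_ciSup hw m
      simp only [w] at h2
      rw [div_le_iff₀ (pow_pos hns _)] at h2
      rw [div_pow, mul_div_assoc']
      gcongr
  refine ⟨ℓ, hℓ0, hlim, ?_⟩
  have h3 := hlim.div hratio one_ne_zero
  rw [div_one] at h3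
  refine h3.congr' ?_
  filter_upwards [eventually_gt_atTop 0] with n hn
  have hn1 : (0 : ℝ) < n := by exact_mod_cast hn
  have hns : (0 : ℝ) < ((n + s : ℕ) : ℝ) := by exact_mod_cast (by omega : 0 < n + s)
  simp only [Pi.div_apply]
  rw [div_pow]
  field_simp
  rfl

end Dimension

/-! ### Lower bound from one level -/

section Key

variable {K B : Type*} [Field K] [CommRing B] [IsDomain B] [Algebra K B]
  {𝓑 : ℕ → Submodule K B} [∀ n, FiniteDimensional K (𝓑 n)] [GradedAlgebra 𝓑]

omit [IsDomain B] in
/-- The slopes of the filtration are linearly bounded below. -/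
theorem QuasiFilteredFrom.exists_lower_bound (hgen : Algebra.adjoin K (𝓑 1 : Set B) = ⊤)
    {f : ℕ → ℝ} {n₀ : ℕ} {F : ∀ n, RFiltration K (𝓑 n)} (hF : QuasiFilteredFrom 𝓑 f n₀ F) :
    ∃ a : ℝ, ∀ᶠ n : ℕ in atTop, filtPiece F n (a * n) = 𝓑 n := by
  choose b hb using fun n => exists_filtPiece_eq F n
  -- Every n ≥ 2N is kN + (N + n mod N). All factors then have degree at least n₀ and less than 2N,
  -- so finitely many constants suffice.
  set N := n₀ + 1 with hN
  set c : ℝ := ∑ i ∈ Finset.range (2 * N), |b i - f i| with hc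
  have hci : ∀ i < 2 * N, -c ≤ b i - f i := fun i hi => by
    have h1 : |b i - f i| ≤ c := Finset.single_le_sum (f := fun i => |b i - f i|)
      (fun _ _ => abs_nonneg _) (Finset.mem_range.2 hi)
    have := neg_abs_le (b i - f i)
    linarith
  have hc0 : 0 ≤ c := Finset.sum_nonneg fun _ _ => abs_nonneg _
  refine ⟨-c, ?_⟩
  filter_upwards [eventually_ge_atTop (2 * N)] with n hn
  refine le_antisymm (filtPiece_le F n _) ?_
  have hdm := Nat.div_add_mod n N
  have hmod := Nat.mod_lt n (show 0 < N by omega)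
  have hdiv : 2 ≤ n / N := by
    rw [Nat.le_div_iff_mul_le (by omega)]
    exact hn
  obtain ⟨k, hk⟩ : ∃ k, n / N = k + 1 := ⟨n / N - 1, by omega⟩
  have hnk : n = k * N + 1 * (N + n % N) := by
    rw [hk] at hdm
    have : N * (k + 1) = k * N + N := by ring
    omega
  have h1 := hF.pow_mul_pow_le (p := N) (q := N + n % N) (k := k) (M := 1) (N := n)
    (by omega) (by omega) (by omega) hnk (b N) (b (N + n % N))
  rw [hb, hb] at h1
  have h2 : 𝓑 n = 𝓑 N ^ k * 𝓑 (N + n % N) ^ 1 := by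
    rw [gradedPiece_eq_pow 𝓑 hgen n, gradedPiece_eq_pow 𝓑 hgen N,
      gradedPiece_eq_pow 𝓑 hgen (N + n % N), ← pow_mul, ← pow_mul, ← pow_add]
    congr 1
    rw [mul_comm N k, mul_one]
    omega
  rw [h2]
  refine h1.trans (filtPiece_mono F n ?_)
  have h3 := hci N (by omega)
  have h4 := hci (N + n % N) (by omega)
  have hkn : (k : ℝ) + 1 ≤ n := by
    have : k + 1 ≤ n := by rw [← hk]; exact Nat.div_le_self _ _
    exact_mod_cast this
  have h5 : (k : ℝ) * -c ≤ k * (b N - f N) := by gcongr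
  push_cast
  nlinarith

/-- The number `dim F_{nt} B_n`. -/
noncomputable def filtDim (F : ∀ n, RFiltration K (𝓑 n)) (n : ℕ) (t : ℝ) : ℝ :=
  Module.finrank K (filtPiece F n (t * n))

/-- Apply the growth inequality to S = F_{tp}B_p. The auxiliary factor V^(ks+n₁) is absorbed in M ≈
ks/p copies of B_p, all of slope at least a. The weighted mean of the slopes is about (pt+sa)/(p+s),
and k + M factors of degree p lose f(p)/p. -/
theorem BoxGrowth.eventually_le_filtDim (hgen : Algebra.adjoin K (𝓑 1 : Set B) = ⊤)
    (hB₁ : 𝓑 1 ≠ ⊥) {s n₁ : ℕ} (hV : BoxGrowth (𝓑 1) s n₁)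
    {f : ℕ → ℝ} (hf : Tendsto (fun n : ℕ => f n / (n : ℝ)) atTop (𝓝 0))
    {n₀ : ℕ} {F : ∀ n, RFiltration K (𝓑 n)} (hF : QuasiFilteredFrom 𝓑 f n₀ F)
    {p : ℕ} (hp : 0 < p) (hpn : n₀ ≤ p) {a t τ c : ℝ} (ha : filtPiece F p (a * p) = 𝓑 p)
    (hτ : τ < (p * t + s * a) / (p + s) - f p / p)
    (hc : c < filtDim F p t / ((p + s : ℕ) : ℝ) ^ s) :
    ∀ᶠ n : ℕ in atTop, c * (n : ℝ) ^ s ≤ filtDim F n τ := by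
  obtain ⟨x₀, hx, hx0⟩ := (𝓑 1).ne_bot_iff.1 hB₁
  have hpow := gradedPiece_eq_pow 𝓑 hgen
  set S := filtPiece F p (t * p) with hS
  obtain ⟨E, hE, hk⟩ := hV p S ((filtPiece_le F p _).trans (hpow p).le)
  choose b hb using fun n => exists_filtPiece_eq F n
  set σ := (p * t + s * a) / (p + s) - f p / p with hσ
  have hp0 : (0 : ℝ) < p := by exact_mod_cast hp
  have hps0 : (0 : ℝ) < p + s := by positivity
  set Δ := E * p * (p + s) with hΔ
  set N₀ := p * (2 + s + n₁) with hN₀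
  set c₁ : ℝ := ∑ i ∈ Finset.range (n₀ + Δ), |b i - f i| with hc₁
  have hci : ∀ i < n₀ + Δ, -c₁ ≤ b i - f i := fun i hi => by
    have h1 : |b i - f i| ≤ c₁ := Finset.single_le_sum (f := fun i => |b i - f i|)
      (fun _ _ => abs_nonneg _) (Finset.mem_range.2 hi)
    have := neg_abs_le (b i - f i)
    linarith
  set A₀ : ℝ := t * p - f p + (s + n₁ + 1) * (a * p - f p) with hA₀
  set D : ℝ := |A₀| + (N₀ + n₀ + Δ) * |σ| + c₁ with hD
  -- One half of the gap absorbs the bounded error D, the other the single value f(N) paid when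
  -- passing from degree N to n.
  set ε := (σ - τ) / 2 with hε
  have hε0 : 0 < ε := by rw [hε]; linarith
  -- the error terms are negligible
  have herr : ∀ᶠ n : ℕ in atTop, D ≤ ε * n := by
    have := (tendsto_natCast_atTop_atTop (R := ℝ)).const_mul_atTop hε0
    exact this.eventually_ge_atTop D
  obtain ⟨N₂, hN₂⟩ : ∃ N₂ : ℕ, ∀ n ≥ N₂, f n ≤ ε * n := by
    obtain ⟨N₂, hN₂⟩ := eventually_atTop.1 ((hf.eventually (gt_mem_nhds hε0)).and
      (eventually_gt_atTop 0))
    refine ⟨N₂, fun n hn => ?_⟩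
    obtain ⟨h1, h2⟩ := hN₂ n hn
    have : (0 : ℝ) < n := by exact_mod_cast h2
    rw [div_lt_iff₀ this] at h1
    exact h1.le
  refine eventually_le_of_arithmetic_lower_bound (u := fun n => filtDim F n τ) (N₀ := N₀)
    (ρ₀ := n₀) (E := E * p) (P := p + s) (σ := filtDim F p t) (Nat.mul_pos hE hp) (by omega)
    (Nat.cast_nonneg _) ?_ hc
  filter_upwards [herr, eventually_ge_atTop (N₂ + n₀ + Δ)] with n hn hnN j ρ hρ hρ' hnj
  -- The modulus E is enlarged to E p so that ks - s is a multiple of p; M is chosen with M p ≥ ks +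
  -- n₁.
  set k := 1 + E * p * j with hkdef
  set M := E * j * s + (s + n₁ + 1) with hM
  set N := N₀ + j * (E * p * (p + s)) with hNdef
  have hN : N = k * p + M * p := by
    rw [hNdef, hkdef, hM, hN₀]
    ring
  have hMp : k * s + n₁ ≤ M * p := by
    have : M * p = E * p * j * s + (s + n₁ + 1) * p := by rw [hM]; ring
    rw [this, hkdef]
    have : (1 + E * p * j) * s = E * p * j * s + s := by ring
    rw [this]
    have : s + n₁ + 1 ≤ (s + n₁ + 1) * p := Nat.le_mul_of_pos_right _ hp
    omega
  have hkpos : 1 ≤ k := by omega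
  have hNp : p ≤ N := by
    rw [hN]
    nlinarith
  -- dimension count
  have hdim : k ^ s * Module.finrank K S ≤ Module.finrank K ↥(S ^ k * 𝓑 p ^ M) := by
    refine (hk (p * j) k (by rw [hkdef]; ring)).trans ?_
    have : FiniteDimensional K ↥(S ^ k * 𝓑 p ^ M) :=
      Module.Finite.iff_fg.2 (((Module.Finite.iff_fg.1 inferInstance).pow k).mul
        ((Module.Finite.iff_fg.1 inferInstance).pow M))
    refine finrank_le_of_mul_mem (x := x₀ ^ (M * p - (k * s + n₁))) (pow_ne_zero _ hx0)
      fun m hm => ?_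
    have h1 : 𝓑 p ^ M = 𝓑 1 ^ (M * p - (k * s + n₁)) * 𝓑 1 ^ (k * s + n₁) := by
      rw [hpow p, ← pow_mul, ← pow_add, Nat.sub_add_cancel hMp, mul_comm]
    rw [h1, mul_left_comm]
    exact Submodule.mul_mem_mul (Submodule.pow_mem_pow _ hx _) hm
  set T : ℝ := k * (t * p - f p) + M * (a * p - f p) with hT
  have hsub : S ^ k * 𝓑 p ^ M ≤ filtPiece F N T := by
    have h1 := hF.pow_mul_pow_le (k := k) (M := M) hpn hpn (by omega) hN (t * p) (a * p)
    rwa [ha] at h1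
  have hshift : ∀ m ∈ S ^ k * 𝓑 p ^ M, x₀ ^ ρ * m ∈ filtPiece F n (τ * n) := by
    intro m hm
    -- Multiplication by x₀^ρ, an injective map, moves from degree N to the given n.
    have hxρ : x₀ ^ ρ ∈ filtPiece F ρ (b ρ) := by
      rw [hb, hpow]
      exact Submodule.pow_mem_pow _ hx _
    have h1 := hF.pow_mul_pow_le (p := N) (q := ρ) (k := 1) (M := 1) (N := n) (hpn.trans hNp) hρ
      le_rfl (by rw [hnj, one_mul, one_mul]) T (b ρ)
    rw [pow_one, pow_one] at h1
    rw [mul_comm (x₀ ^ ρ) m]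
    refine filtPiece_mono F n ?_ (h1 (Submodule.mul_mem_mul (hsub hm) hxρ))
    have hfN : f N ≤ ε * N := hN₂ N (by omega)
    have hNn : (N : ℝ) ≤ n := by exact_mod_cast (by omega : N ≤ n)
    have hbρ := hci ρ hρ'
    have hTeq : T = A₀ + (n - N₀ - ρ) * σ := by
      have hnr : (n : ℝ) - N₀ - ρ = j * (E * p * (p + s)) := by
        rw [hnj, hNdef]
        push_cast
        ring
      rw [hnr, hT, hkdef, hM, hA₀, hσ]
      push_cast
      field_simp
      ring
    have hA : -|A₀| ≤ A₀ := neg_abs_le _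
    have hρr : (ρ : ℝ) ≤ n₀ + Δ := by exact_mod_cast hρ'.le
    have hσ1 : ((N₀ : ℝ) + ρ) * σ ≤ (N₀ + n₀ + Δ) * |σ| := by
      calc ((N₀ : ℝ) + ρ) * σ ≤ ((N₀ : ℝ) + ρ) * |σ| := by
            gcongr
            exact le_abs_self σ
        _ ≤ _ := by
            gcongr ?_ * _
            linarith
    have hεN : ε * N ≤ ε * n := by gcongr
    have hτσ : τ = σ - 2 * ε := by rw [hε]; ring
    rw [hTeq, hτσ]
    push_cast
    linarith
  have hfin : k ^ s * Module.finrank K S ≤ Module.finrank K (filtPiece F n (τ * n)) :=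
    hdim.trans (finrank_le_of_mul_mem (pow_ne_zero ρ hx0) hshift)
  simp only [filtDim]
  exact_mod_cast hfin

end Key

/-! ### Comparison of normalised ranks -/

section Ratio

variable {K B : Type*} [Field K] [CommRing B] [IsDomain B] [Algebra K B]
  {𝓑 : ℕ → Submodule K B} [∀ n, FiniteDimensional K (𝓑 n)] [GradedAlgebra 𝓑]

/-- The number `dim F_{nt} B_n / dim B_n`. -/
noncomputable def filtRatio (F : ∀ n, RFiltration K (𝓑 n)) (n : ℕ) (t : ℝ) : ℝ :=
  filtDim F n t / Module.finrank K (𝓑 n)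

theorem finrank_gradedPiece_pos (hB₁ : 𝓑 1 ≠ ⊥) (n : ℕ) : 0 < Module.finrank K (𝓑 n) := by
  obtain ⟨x, hx, hx0⟩ := (𝓑 1).ne_bot_iff.1 hB₁
  refine Module.finrank_pos_iff_exists_ne_zero.2 ⟨⟨x ^ n, ?_⟩, fun h => pow_ne_zero n hx0
    (congrArg Subtype.val h)⟩
  exact gradedPiece_one_pow_le 𝓑 n (Submodule.pow_mem_pow _ hx n)

/-- The asymptotic distribution of slopes is bounded below by the distribution at a finite level,
uniformly in the filtration. -/
theorem exists_forall_eventually_lt_filtRatio (hgen : Algebra.adjoin K (𝓑 1 : Set B) = ⊤)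
    (hB₁ : 𝓑 1 ≠ ⊥) {f : ℕ → ℝ} (hf : Tendsto (fun n : ℕ => f n / (n : ℝ)) atTop (𝓝 0))
    (n₀ : ℕ) {τ t q q' : ℝ} (a : ℝ) (hτ : τ < t) (hq : q' < q) :
    ∃ p₀ : ℕ, ∀ p ≥ p₀, ∀ F : ∀ n, RFiltration K (𝓑 n), QuasiFilteredFrom 𝓑 f n₀ F →
      filtPiece F p (a * p) = 𝓑 p → q < filtRatio F p t →
      ∀ᶠ n in atTop, q' < filtRatio F n τ := by
  have hpos : ∀ n, (0 : ℝ) < Module.finrank K (𝓑 n) := fun n =>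
    Nat.cast_pos.2 (finrank_gradedPiece_pos hB₁ n)
  rcases lt_or_ge q' 0 with hq0 | hq0
  · refine ⟨0, fun p _ F _ _ _ => Eventually.of_forall fun n => hq0.trans_le ?_⟩
    exact div_nonneg (Nat.cast_nonneg _) (hpos n).le
  obtain ⟨x₀, hx, hx0⟩ := (𝓑 1).ne_bot_iff.1 hB₁
  obtain ⟨s, C, y, R, D⟩ := exists_latticeData (𝓑 1) hx hx0
  obtain ⟨n₁, hV⟩ : ∃ n₁, BoxGrowth (𝓑 1) s n₁ := D.exists_le_finrank_pow_mul
  obtain ⟨ℓ, hℓ, hlim, hlim'⟩ := hV.exists_tendsto hx hx0 D.growth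
  have hpow : ∀ n, Module.finrank K ↥(𝓑 1 ^ n) = Module.finrank K (𝓑 n) := fun n => by
    rw [gradedPiece_eq_pow 𝓑 hgen n]
  simp_rw [hpow] at hlim hlim'
  have hqpos : 0 < q := hq0.trans_lt hq
  -- The passage from q to q₂ pays for replacing dim B_p by ℓ (p+s)^s, that from q₂ to q' for
  -- replacing dim B_n by ℓ n^s.
  obtain ⟨q₂, hq₂, hq₂'⟩ := exists_between hq
  have hq₂pos : 0 < q₂ := hq0.trans_lt hq₂
  have h1 : ∀ᶠ p : ℕ in atTop, q₂ * ℓ / q < (Module.finrank K (𝓑 p) : ℝ) / ((p + s : ℕ) : ℝ) ^ s :=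
    hlim'.eventually (lt_mem_nhds (by
      rw [div_lt_iff₀ hqpos, mul_comm]
      gcongr))
  have h2 : ∀ᶠ p : ℕ in atTop, τ < (p * t + s * a) / (p + s) - f p / p := by
    have h3 : Tendsto (fun p : ℕ => (t + s * a / p) / (1 + s / p) - f p / p) atTop
        (𝓝 ((t + 0) / (1 + 0) - 0)) :=
      (((tendsto_const_div_atTop_nhds_zero_nat ((s : ℝ) * a)).const_add t).div
        ((tendsto_const_div_atTop_nhds_zero_nat (s : ℝ)).const_add 1) (by norm_num)).sub hf
    filter_upwards [h3.eventually (lt_mem_nhds (by simpa using hτ)), eventually_gt_atTop 0]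
      with p hp hp0
    refine hp.trans_eq ?_
    have : (0 : ℝ) < p := by exact_mod_cast hp0
    congr 1
    field_simp
  have h3 : ∀ᶠ n : ℕ in atTop, q' * (Module.finrank K (𝓑 n) : ℝ) < q₂ * ℓ * (n : ℝ) ^ s := by
    have := hlim.const_mul q'
    filter_upwards [this.eventually (gt_mem_nhds (show q' * ℓ < q₂ * ℓ by gcongr)),
      eventually_gt_atTop 0] with n hn hn0
    have : (0 : ℝ) < (n : ℝ) ^ s := pow_pos (by exact_mod_cast hn0) _
    rwa [mul_div_assoc', div_lt_iff₀ this] at hn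
  obtain ⟨p₀, hp₀⟩ := eventually_atTop.1 (h1.and h2)
  refine ⟨p₀ + n₀ + 1, fun p hp F hF ha hqF => ?_⟩
  obtain ⟨h4, h5⟩ := hp₀ p (by omega)
  have hc : q₂ * ℓ < filtDim F p t / ((p + s : ℕ) : ℝ) ^ s := by
    have hps : (0 : ℝ) < ((p + s : ℕ) : ℝ) ^ s := pow_pos (by exact_mod_cast (by omega)) _
    rw [filtRatio, lt_div_iff₀ (hpos p)] at hqF
    rw [div_lt_iff₀ hqpos] at h4
    refine h4.trans_le ?_
    rw [div_mul_eq_mul_div]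
    gcongr
    linarith
  filter_upwards [hV.eventually_le_filtDim hgen hB₁ hf hF (by omega) (by omega) ha h5 hc, h3]
    with n hn hn'
  rw [filtRatio, lt_div_iff₀ (hpos n)]
  exact hn'.trans_le hn

/-- One level beyond p₀ with a large ratio suffices, and infinitely many are available: limsup at t
is at most liminf at τ. -/
theorem frequently_lt_filtRatio (hgen : Algebra.adjoin K (𝓑 1 : Set B) = ⊤)
    (hB₁ : 𝓑 1 ≠ ⊥) {f : ℕ → ℝ} (hf : Tendsto (fun n : ℕ => f n / (n : ℝ)) atTop (𝓝 0))
    {n₀ : ℕ} {F : ∀ n, RFiltration K (𝓑 n)} (hF : QuasiFilteredFrom 𝓑 f n₀ F)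
    {τ t q q' : ℝ} (hτ : τ < t) (hq : q' < q) (h : ∃ᶠ p in atTop, q < filtRatio F p t) :
    ∀ᶠ n in atTop, q' < filtRatio F n τ := by
  obtain ⟨a, ha⟩ := hF.exists_lower_bound hgen
  obtain ⟨p₀, hp₀⟩ := exists_forall_eventually_lt_filtRatio hgen hB₁ hf n₀ a hτ hq
  obtain ⟨p, hqp, hap, hp⟩ := (h.and_eventually (ha.and (eventually_ge_atTop p₀))).exists
  exact hp₀ p hp F hF hap hqp

theorem filtRatio_eq_one (hB₁ : 𝓑 1 ≠ ⊥) {F : ∀ n, RFiltration K (𝓑 n)} {n : ℕ} {t : ℝ}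
    (h : filtPiece F n (t * n) = 𝓑 n) : filtRatio F n t = 1 := by
  rw [filtRatio, filtDim, h, div_self]
  exact (Nat.cast_pos.2 (finrank_gradedPiece_pos hB₁ n)).ne'

omit [IsDomain B] [GradedAlgebra 𝓑] in
theorem filtRatio_eq_zero {F : ∀ n, RFiltration K (𝓑 n)} {C : ℝ} {n : ℕ} (hn : 1 ≤ n)
    (hmax : ∀ x : 𝓑 n, x ≠ 0 → (F n).lam x ≤ ((C * n : ℝ) : EReal)) {t : ℝ} (ht : C < t) :
    filtRatio F n t = 0 := by
  have : (F n).sub (t * n) = ⊥ := by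
    rw [Submodule.eq_bot_iff]
    intro x hx
    by_contra hx0
    have h1 := ((F n).coe_le_lam_iff.2 hx).trans (hmax x hx0)
    have h2 := EReal.coe_le_coe_iff.1 h1
    have hn0 : (0 : ℝ) < n := by exact_mod_cast hn
    exact absurd (le_of_mul_le_mul_right h2 hn0) (not_le.2 ht)
  rw [filtRatio, filtDim, finrank_filtPiece, this, finrank_bot]
  simp

end Ratio

/-! ### Slope measures and their half-lines -/

namespace Monotone

variable {g : ℝ → ℝ} (hg : Monotone g) {l u : ℝ}

/-- The Stieltjes function replaces g by its right limits, which does not change left limits. -/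
theorem stieltjes_measure_Ici (hu : Tendsto g atTop (𝓝 u)) (t : ℝ) :
    hg.stieltjesFunction.measure (Set.Ici t) = ENNReal.ofReal (u - Function.leftLim g t) := by
  rw [StieltjesFunction.measure_Ici _ (show Tendsto hg.stieltjesFunction atTop (𝓝 u) from
    tendsto_rightLim_atTop_of_tendsto hu)]
  congr 2
  exact leftLim_rightLim (hg.tendsto_leftLim t)

theorem isProbabilityMeasure_stieltjes (hl : Tendsto g atBot (𝓝 l)) (hu : Tendsto g atTop (𝓝 u))
    (h : u - l = 1) : IsProbabilityMeasure hg.stieltjesFunction.measure := by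
  refine ⟨?_⟩
  rw [StieltjesFunction.measure_univ _ (show Tendsto hg.stieltjesFunction atBot (𝓝 l) from
    tendsto_rightLim_atBot_of_tendsto hl) (show Tendsto hg.stieltjesFunction atTop (𝓝 u) from
    tendsto_rightLim_atTop_of_tendsto hu), h, ENNReal.ofReal_one]

end Monotone

namespace RFiltration

variable {K W : Type*} [Field K] [AddCommGroup W] [Module K W] [FiniteDimensional K W]

theorem leftLim_negRank (F : RFiltration K W) (t : ℝ) :
    Function.leftLim F.negRank t = F.negRank t :=
  ContinuousWithinAt.leftLim_eq (((F.left_cont t).div_const _).neg)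

theorem tendsto_negRank_atTop (F : RFiltration K W) : Tendsto F.negRank atTop (𝓝 0) := by
  refine tendsto_const_nhds.congr' ?_
  filter_upwards [F.eventually_bot] with t ht
  simp [negRank, ht]

theorem tendsto_negRank_atBot (F : RFiltration K W) (hW : 0 < Module.finrank K W) :
    Tendsto F.negRank atBot (𝓝 (-1)) := by
  refine tendsto_const_nhds.congr' ?_
  filter_upwards [F.eventually_top] with t ht
  have : (Module.finrank K W : ℝ) ≠ 0 := Nat.cast_ne_zero.2 hW.ne'
  rw [negRank, ht, finrank_top, div_self this]

theorem isProbabilityMeasure_measure (F : RFiltration K W) (hW : 0 < Module.finrank K W) :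
    IsProbabilityMeasure F.measure :=
  F.monotone_negRank.isProbabilityMeasure_stieltjes (F.tendsto_negRank_atBot hW)
    F.tendsto_negRank_atTop (by norm_num)

theorem isProbabilityMeasure_scaledMeasure (F : RFiltration K W) (hW : 0 < Module.finrank K W)
    (n : ℕ) : IsProbabilityMeasure (F.scaledMeasure n) := by
  have := F.isProbabilityMeasure_measure hW
  exact Measure.isProbabilityMeasure_map (measurable_const_mul _).aemeasurable

theorem scaledMeasure_Ici (F : RFiltration K W) {n : ℕ} (hn : 0 < n) (t : ℝ) :
    F.scaledMeasure n (Set.Ici t) = ENNReal.ofReal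
      ((Module.finrank K (F.sub (t * n)) : ℝ) / (Module.finrank K W : ℝ)) := by
  have hn0 : (0 : ℝ) < n := by exact_mod_cast hn
  have hpre : (fun x : ℝ => (1 / (n : ℝ)) * x) ⁻¹' Set.Ici t = Set.Ici (t * n) := by
    ext x
    simp only [Set.mem_preimage, Set.mem_Ici, one_div_mul_eq_div]
    exact le_div_iff₀ hn0
  rw [scaledMeasure, Measure.map_apply (measurable_const_mul _) measurableSet_Ici, hpre, measure,
    F.monotone_negRank.stieltjes_measure_Ici F.tendsto_negRank_atTop, leftLim_negRank, negRank]
  congr 1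
  ring

end RFiltration

theorem scaledMeasure_real_Ici {K B : Type*} [Field K] [CommRing B] [Algebra K B]
    {𝓑 : ℕ → Submodule K B} [∀ n, FiniteDimensional K (𝓑 n)] (F : ∀ n, RFiltration K (𝓑 n))
    {n : ℕ} (hn : 0 < n) (t : ℝ) :
    ((F n).scaledMeasure n).real (Set.Ici t) = filtRatio F n t := by
  rw [Measure.real, (F n).scaledMeasure_Ici hn, ENNReal.toReal_ofReal (by positivity), filtRatio,
    filtDim, finrank_filtPiece]

/-! ### Convergence on the line through half-lines -/

/-- By inner regularity a compact subset of U already has mass above q, and it lies in the half-line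
starting at its least point. -/
theorem exists_lt_measure_Ici {ν : Measure ℝ} [IsFiniteMeasure ν] {U : Set ℝ} (hU : IsOpen U)
    {q : ENNReal} (hq : q < ν U) : ∃ t ∈ U, q < ν (Set.Ici t) := by
  obtain ⟨k, hkU, hk, hqk⟩ := hU.exists_lt_isCompact hq
  have hne : k.Nonempty := by
    rw [Set.nonempty_iff_ne_empty]
    rintro rfl
    simp at hqk
  obtain ⟨t, ht, htmin⟩ := hk.exists_isLeast hne
  exact ⟨t, hkU ht, hqk.trans_le (measure_mono htmin)⟩

theorem exists_lt_measureReal_Ici {ν : Measure ℝ} [IsFiniteMeasure ν] {U : Set ℝ} (hU : IsOpen U)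
    {q : ℝ} (hq0 : 0 ≤ q) (hq : q < ν.real U) : ∃ t ∈ U, q < ν.real (Set.Ici t) := by
  have h1 : ENNReal.ofReal q < ν U := by
    rwa [ENNReal.ofReal_lt_iff_lt_toReal hq0 (measure_ne_top _ _)]
  obtain ⟨t, ht, hqt⟩ := exists_lt_measure_Ici hU h1
  exact ⟨t, ht, (ENNReal.ofReal_lt_iff_lt_toReal hq0 (measure_ne_top _ _)).1 hqt⟩

/-- Weak convergence of probability measures on the line from the convergence of the measures of
half-lines. -/
theorem tendsto_probabilityMeasure_of_Ici {μ : ℕ → ProbabilityMeasure ℝ} {ν : ProbabilityMeasure ℝ}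
    (hlow : ∀ τ t q, τ < t → q < (ν : Measure ℝ).real (Set.Ici t) →
      ∀ᶠ n in atTop, q < (μ n : Measure ℝ).real (Set.Ici τ))
    (hupp : ∀ t q, (∃ᶠ n in atTop, q < (μ n : Measure ℝ).real (Set.Ici t)) →
      q ≤ (ν : Measure ℝ).real (Set.Ici t)) :
    Tendsto μ atTop (𝓝 ν) := by
  -- At points without mass the open and closed half-lines agree, so both hypotheses meet there.
  -- Such points are dense, and intervals with ends among them form a π-system fine enough to
  -- determine weak convergence.
  set D : Set ℝ := {t | (ν : Measure ℝ) {t} = 0} with hD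
  have hDc : Dᶜ.Countable := by
    have := Measure.countable_meas_pos_of_disjoint_iUnion (μ := (ν : Measure ℝ))
      (As := fun t : ℝ => {t}) (fun t => measurableSet_singleton t)
      (fun s t hst => Set.disjoint_singleton.2 hst)
    refine this.mono fun t ht => ?_
    exact pos_iff_ne_zero.2 ht
  have hDd : Dense D := by
    have := hDc.dense_compl ℝ
    rwa [compl_compl] at this
  have hlim : ∀ t ∈ D, Tendsto (fun n => (μ n : Measure ℝ).real (Set.Ici t)) atTop
      (𝓝 ((ν : Measure ℝ).real (Set.Ici t))) := by
    intro t ht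
    rw [tendsto_order]
    constructor
    · intro q hq
      rcases lt_or_ge q 0 with hq0 | hq0
      · exact Eventually.of_forall fun n => hq0.trans_le measureReal_nonneg
      have h1 : (ν : Measure ℝ).real (Set.Ioi t) = (ν : Measure ℝ).real (Set.Ici t) := by
        rw [Measure.real, Measure.real]
        congr 1
        exact measure_congr (Ioi_ae_eq_Ici' ht)
      rw [← h1] at hq
      obtain ⟨t', ht', hq'⟩ := exists_lt_measureReal_Ici isOpen_Ioi hq0 hq
      exact hlow t t' q ht' hq'
    · intro q hq
      obtain ⟨q', hq1, hq2⟩ := exists_between hq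
      have h1 : ¬ ∃ᶠ n in atTop, q' < (μ n : Measure ℝ).real (Set.Ici t) := fun h =>
        absurd (hupp t q' h) (not_le.2 hq1)
      rw [not_frequently] at h1
      filter_upwards [h1] with n hn
      exact (not_lt.1 hn).trans_lt hq2
  have hIco : ∀ (ρ : ProbabilityMeasure ℝ) (x y : ℝ), x ≤ y → (ρ : Measure ℝ).real (Set.Ico x y) =
      (ρ : Measure ℝ).real (Set.Ici x) - (ρ : Measure ℝ).real (Set.Ici y) := by
    intro ρ x y hxy
    rw [← Set.Ici_sdiff_Ici, measureReal_sdiff (Set.Ici_subset_Ici.2 hxy) measurableSet_Ici]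
  refine IsPiSystem.tendsto_probabilityMeasure_of_tendsto_of_mem
    (S := {A | ∃ x ∈ D, ∃ y ∈ D, x < y ∧ A = Set.Ico x y}) ?_ ?_ ?_ ?_
  · rintro _ ⟨x, hx, y, hy, hxy, rfl⟩ _ ⟨x', hx', y', hy', hxy', rfl⟩ hne
    rw [Set.Ico_inter_Ico] at hne ⊢
    refine ⟨x ⊔ x', ?_, y ⊓ y', ?_, Set.nonempty_Ico.1 hne, rfl⟩
    · rcases max_choice x x' with h | h <;> rw [h] <;> assumption
    · rcases min_choice y y' with h | h <;> rw [h] <;> assumption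
  · rintro _ ⟨x, hx, y, hy, hxy, rfl⟩
    exact measurableSet_Ico
  · intro u hu x hx
    obtain ⟨l, r, ⟨hl, hr⟩, hlr⟩ := mem_nhds_iff_exists_Ioo_subset.1 (hu.mem_nhds hx)
    obtain ⟨l', hl'D, hl'⟩ := hDd.exists_between hl
    obtain ⟨r', hr'D, hr'⟩ := hDd.exists_between hr
    refine ⟨Set.Ico l' r', ⟨l', hl'D, r', hr'D, hl'.2.trans hr'.1, rfl⟩,
      Ico_mem_nhds hl'.2 hr'.1, fun z hz => hlr ⟨hl'.1.trans_le hz.1, hz.2.trans hr'.2⟩⟩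
  · rintro _ ⟨x, hx, y, hy, hxy, rfl⟩
    have h1 := (hlim x hx).sub (hlim y hy)
    rw [← hIco ν x y hxy.le] at h1
    simp only [← hIco _ x y hxy.le] at h1
    rw [← NNReal.tendsto_coe]
    exact h1

/-- Construction of the limit of a sequence of probability measures on the line. -/
theorem exists_probabilityMeasure_limit (μ : ℕ → Measure ℝ) [∀ n, IsProbabilityMeasure (μ n)]
    {a b : ℝ} (ha : ∀ᶠ n in atTop, (μ n).real (Set.Ici a) = 1)
    (hb : ∀ᶠ n in atTop, (μ n).real (Set.Ici b) = 0)
    (hcmp : ∀ τ t q q', τ < t → q' < q → (∃ᶠ n in atTop, q < (μ n).real (Set.Ici t)) →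
      ∀ᶠ n in atTop, q' < (μ n).real (Set.Ici τ)) :
    ∃ ν : Measure ℝ, IsProbabilityMeasure ν ∧ VaguelyConverges μ ν ∧
      (∀ τ t q, τ < t → q < ν.real (Set.Ici t) → ∀ᶠ n in atTop, q < (μ n).real (Set.Ici τ)) ∧
      (∀ t q, (∃ᶠ n in atTop, q < (μ n).real (Set.Ici t)) → q ≤ ν.real (Set.Ici t)) := by
  -- The limsup of the tails is a candidate tail function. Its left limits are the tails of ν, and
  -- `hcmp` bounds the liminf from below by them after a small move to the left.
  set R : ℝ → ℝ := fun t => limsup (fun n => (μ n).real (Set.Ici t)) atTop with hR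
  have hbdd : ∀ t, IsBoundedUnder (· ≤ ·) atTop (fun n => (μ n).real (Set.Ici t)) := fun t =>
    isBoundedUnder_of ⟨1, fun n => measureReal_le_one⟩
  have hcobdd : ∀ t, IsCoboundedUnder (· ≤ ·) atTop (fun n => (μ n).real (Set.Ici t)) := fun t =>
    (isBoundedUnder_of (r := (· ≥ ·)) ⟨0, fun n => measureReal_nonneg⟩).isCoboundedUnder_le
  have hmonoI : ∀ n, ∀ {s t : ℝ}, s ≤ t → (μ n).real (Set.Ici t) ≤ (μ n).real (Set.Ici s) :=
    fun n s t h => measureReal_mono (Set.Ici_subset_Ici.2 h)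
  have hg : Monotone fun t => -R t := fun s t hst => neg_le_neg
    (limsup_le_limsup (Eventually.of_forall fun n => hmonoI n hst) (hcobdd t) (hbdd s))
  have hRb : ∀ t ≥ b, R t = 0 := by
    intro t ht
    have : (fun n => (μ n).real (Set.Ici t)) =ᶠ[atTop] fun _ => 0 := by
      filter_upwards [hb] with n hn
      exact le_antisymm ((hmonoI n ht).trans hn.le) measureReal_nonneg
    rw [hR]
    simp only
    rw [limsup_congr this, limsup_const]
  have hRa : ∀ t ≤ a, R t = 1 := by
    intro t ht
    have : (fun n => (μ n).real (Set.Ici t)) =ᶠ[atTop] fun _ => 1 := by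
      filter_upwards [ha] with n hn
      exact le_antisymm measureReal_le_one (hn.symm.le.trans (hmonoI n ht))
    rw [hR]
    simp only
    rw [limsup_congr this, limsup_const]
  have htop : Tendsto (fun t => -R t) atTop (𝓝 0) := by
    refine tendsto_const_nhds.congr' ?_
    filter_upwards [eventually_ge_atTop b] with t ht
    rw [hRb t ht, neg_zero]
  have hbot : Tendsto (fun t => -R t) atBot (𝓝 (-1)) := by
    refine tendsto_const_nhds.congr' ?_
    filter_upwards [eventually_le_atBot a] with t ht
    rw [hRa t ht]
  set ν := hg.stieltjesFunction.measure with hν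
  have hprob : IsProbabilityMeasure ν :=
    hg.isProbabilityMeasure_stieltjes hbot htop (by norm_num)
  have hνI : ∀ t, ν.real (Set.Ici t) = -Function.leftLim (fun t => -R t) t := by
    intro t
    rw [Measure.real, hν, hg.stieltjes_measure_Ici htop, zero_sub, ENNReal.toReal_ofReal]
    have h1 := hg.leftLim_le (le_refl t)
    have h2 : 0 ≤ R t := by
      refine le_limsup_of_frequently_le (Frequently.of_forall fun n => measureReal_nonneg) (hbdd t)
    linarith
  have hlow : ∀ τ t q, τ < t → q < ν.real (Set.Ici t) →
      ∀ᶠ n in atTop, q < (μ n).real (Set.Ici τ) := by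
    intro τ t q hτ hq
    obtain ⟨τ', h1, h2⟩ := exists_between hτ
    obtain ⟨q', hq1, hq2⟩ := exists_between hq
    have h3 := hg.le_leftLim h2
    rw [hνI] at hq2
    exact hcmp τ τ' q' q h1 hq1 (frequently_lt_of_lt_limsup (hcobdd τ') (by
      change q' < R τ'
      linarith))
  have hupp : ∀ t q, (∃ᶠ n in atTop, q < (μ n).real (Set.Ici t)) → q ≤ ν.real (Set.Ici t) := by
    intro t q h
    have h1 : q ≤ R t := le_limsup_of_frequently_le (h.mono fun n hn => hn.le) (hbdd t)
    have h2 := hg.leftLim_le (le_refl t)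
    rw [hνI]
    linarith
  refine ⟨ν, hprob, ?_, hlow, hupp⟩
  have hconv := tendsto_probabilityMeasure_of_Ici (μ := fun n => ⟨μ n, inferInstance⟩)
    (ν := ⟨ν, hprob⟩) hlow hupp
  intro h hc hs
  obtain ⟨C, hC⟩ := hc.bounded_above_of_compact_support hs
  exact ProbabilityMeasure.tendsto_iff_forall_integral_tendsto.1 hconv
    (BoundedContinuousFunction.ofNormedAddCommGroup h hc C hC)

theorem integrable_of_measure_Icc_compl {ν : Measure ℝ} [IsFiniteMeasure ν] {a b : ℝ}
    (h : ν (Set.Icc a b)ᶜ = 0) {φ : ℝ → ℝ} (hφ : Continuous φ) : Integrable φ ν := by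
  have h1 : IntegrableOn φ (Set.Icc a b) ν := hφ.continuousOn.integrableOn_Icc
  have h2 : ν.restrict (Set.Icc a b) = ν := Measure.restrict_eq_self_of_ae_mem h
  rwa [IntegrableOn, h2] at h1

/-- In the layer cake formula the superlevel sets of g are open and closed upwards, so some [τ,∞)
with τ < t still fits inside and pays for the loss from t to τ. Fatou's lemma concludes. -/
theorem lintegral_le_liminf_of_Ici {ν : Measure ℝ} [IsFiniteMeasure ν] {μ : ℕ → Measure ℝ}
    (h : ∀ τ t q, τ < t → q < ν (Set.Ici t) → ∀ᶠ m in atTop, q ≤ μ m (Set.Ici τ))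
    {g : ℝ → ℝ} (hg : Continuous g) (hmono : Monotone g) (hg0 : 0 ≤ g) :
    ∫⁻ x, ENNReal.ofReal (g x) ∂ν ≤ liminf (fun m => ∫⁻ x, ENNReal.ofReal (g x) ∂(μ m)) atTop := by
  simp_rw [lintegral_eq_lintegral_meas_lt _ (Eventually.of_forall hg0) hg.aemeasurable]
  calc ∫⁻ (t : ℝ) in Set.Ioi 0, ν {a | t < g a}
      ≤ ∫⁻ (t : ℝ) in Set.Ioi 0, liminf (fun i => (μ i) {a | t < g a}) atTop := by
        refine lintegral_mono fun s => le_of_forall_lt fun q hq => ?_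
        obtain ⟨q', hq1, hq2⟩ := exists_between hq
        have hU : IsOpen {a | s < g a} := isOpen_lt continuous_const hg
        obtain ⟨t, ht, hqt⟩ := exists_lt_measure_Ici hU hq2
        obtain ⟨l, hl, hlU⟩ := exists_Ioc_subset_of_mem_nhds (hU.mem_nhds ht) ⟨t - 1, by linarith⟩
        obtain ⟨τ, hlτ, hτt⟩ := exists_between hl
        refine hq1.trans_le (le_liminf_of_le (by isBoundedDefault) ?_)
        filter_upwards [h τ t q' hτt hqt] with m hm
        refine hm.trans (measure_mono fun x hx => ?_)
        exact lt_of_lt_of_le (hlU ⟨hlτ, hτt.le⟩ : s < g τ) (hmono hx)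
    _ ≤ liminf (fun i => ∫⁻ (t : ℝ) in Set.Ioi 0, (μ i) {a | t < g a}) atTop :=
        lintegral_liminf_le fun n => Antitone.measurable fun s t hst =>
          measure_mono fun ω hω => lt_of_le_of_lt hst hω

/-- The common lower bound a allows φ to be replaced by the nonnegative function max(φ - φ(a), 0),
to which the layer cake inequality applies. -/
theorem integral_le_limsup_of_Ici {ν : Measure ℝ} [IsProbabilityMeasure ν] {μ : ℕ → Measure ℝ}
    [∀ m, IsProbabilityMeasure (μ m)]
    (h : ∀ τ t q, τ < t → q < ν (Set.Ici t) → ∀ᶠ m in atTop, q ≤ μ m (Set.Ici τ))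
    {φ : ℝ → ℝ} (hφ : Continuous φ) (hmono : Monotone φ) (hint : Integrable φ ν)
    (hint' : ∀ m, Integrable φ (μ m)) {a : ℝ} (ha : ∀ᵐ x ∂ν, a ≤ x)
    (ha' : ∀ᶠ m in atTop, ∀ᵐ x ∂(μ m), a ≤ x) :
    ((∫ x, φ x ∂ν : ℝ) : EReal) ≤ limsup (fun m => ((∫ x, φ x ∂(μ m) : ℝ) : EReal)) atTop := by
  let g : ℝ → ℝ := fun x => max (φ x - φ a) 0
  have hg : Continuous g := (hφ.sub continuous_const).max continuous_const
  have hgm : Monotone g := fun x y hxy => max_le_max (sub_le_sub_right (hmono hxy) _) le_rfl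
  have hg0 : 0 ≤ g := fun x => le_max_right _ _
  have key : ∀ (ρ : Measure ℝ) [IsProbabilityMeasure ρ], Integrable φ ρ → (∀ᵐ x ∂ρ, a ≤ x) →
      ∫⁻ x, ENNReal.ofReal (g x) ∂ρ = ENNReal.ofReal (∫ x, φ x ∂ρ - φ a) ∧
      φ a ≤ ∫ x, φ x ∂ρ := by
    intro ρ _ hi hρ
    have h1 : g =ᵐ[ρ] fun x => φ x - φ a := by
      filter_upwards [hρ] with x hx
      exact max_eq_left (sub_nonneg.2 (hmono hx))
    have h2 : Integrable (fun x => φ x - φ a) ρ := hi.sub (integrable_const _)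
    have h3 : ∫ x, φ x - φ a ∂ρ = ∫ x, φ x ∂ρ - φ a := by
      rw [integral_sub hi (integrable_const _)]
      simp
    constructor
    · rw [← h3, ← integral_congr_ae h1, ofReal_integral_eq_lintegral_ofReal (h2.congr h1.symm)
        (Eventually.of_forall hg0)]
    · have : 0 ≤ ∫ x, φ x - φ a ∂ρ := by
        rw [← integral_congr_ae h1]
        exact integral_nonneg hg0
      linarith
  have hlim := lintegral_le_liminf_of_Ici h hg hgm hg0
  rw [(key ν hint ha).1] at hlim
  refine le_of_forall_lt_imp_le_of_dense fun c hc => ?_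
  induction c with
  | bot => exact bot_le
  | top => exact absurd hc (not_lt.2 le_top)
  | coe c =>
    rw [EReal.coe_lt_coe_iff] at hc
    refine le_trans ?_ (liminf_le_limsup (u := fun m => ((∫ x, φ x ∂(μ m) : ℝ) : EReal)))
    refine le_liminf_of_le (by isBoundedDefault) ?_
    rcases lt_or_ge c (φ a) with hca | hca
    · filter_upwards [ha'] with m hm
      exact EReal.coe_le_coe_iff.2 (hca.le.trans (key (μ m) (hint' m) hm).2)
    · have h1 : ENNReal.ofReal (c - φ a) < ENNReal.ofReal (∫ x, φ x ∂ν - φ a) :=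
        (ENNReal.ofReal_lt_ofReal_iff_of_nonneg (by linarith)).2 (by linarith)
      filter_upwards [ha', eventually_lt_of_lt_liminf (h1.trans_le hlim)] with m hm hm'
      rw [(key (μ m) (hint' m) hm).1, ENNReal.ofReal_lt_ofReal_iff_of_nonneg (by linarith)] at hm'
      exact EReal.coe_le_coe_iff.2 (by linarith)

/-! ### The limit measure of a quasi-filtered algebra -/

section Limit

variable {K B : Type*} [Field K] [CommRing B] [IsDomain B] [Algebra K B]
  {𝓑 : ℕ → Submodule K B} [∀ n, FiniteDimensional K (𝓑 n)] [GradedAlgebra 𝓑]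

theorem ae_ge_of_measureReal_Ici_eq_one {ν : Measure ℝ} [IsProbabilityMeasure ν] {a : ℝ}
    (h : 1 ≤ ν.real (Set.Ici a)) : ∀ᵐ x ∂ν, a ≤ x := by
  have h1 : ν (Set.Ici a) = 1 := by
    refine le_antisymm prob_le_one ?_
    rw [← ENNReal.ofReal_one]
    exact ENNReal.ofReal_le_of_le_toReal h
  exact (prob_compl_eq_zero_iff measurableSet_Ici).2 h1

theorem exists_limit_scaledMeasure (hgen : Algebra.adjoin K (𝓑 1 : Set B) = ⊤) (hB₁ : 𝓑 1 ≠ ⊥)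
    {f : ℕ → ℝ} (hf : Tendsto (fun n : ℕ => f n / (n : ℝ)) atTop (𝓝 0))
    {n₀ : ℕ} {F : ∀ n, RFiltration K (𝓑 n)} (hF : QuasiFilteredFrom 𝓑 f n₀ F)
    (hmax : ∃ C : ℝ, ∀ n : ℕ, 1 ≤ n → ∀ x : 𝓑 n, x ≠ 0 → (F n).lam x ≤ ((C * n : ℝ) : EReal)) :
    ∃ ν : Measure ℝ, IsProbabilityMeasure ν ∧
      VaguelyConverges (fun n => (F n).scaledMeasure n) ν ∧
      (∀ τ t q, τ < t → q < ν.real (Set.Ici t) → ∀ᶠ n in atTop, q < filtRatio F n τ) ∧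
      (∀ t q, (∃ᶠ n in atTop, q < filtRatio F n t) → q ≤ ν.real (Set.Ici t)) ∧
      ∀ φ : ℝ → ℝ, Continuous φ → Integrable φ ν := by
  obtain ⟨C, hC⟩ := hmax
  obtain ⟨a, ha⟩ := hF.exists_lower_bound hgen
  have hprob : ∀ n, IsProbabilityMeasure ((F n).scaledMeasure n) := fun n =>
    (F n).isProbabilityMeasure_scaledMeasure (finrank_gradedPiece_pos hB₁ n) n
  have hone : ∀ᶠ n in atTop, filtRatio F n a = 1 := by
    filter_upwards [ha] with n hn
    exact filtRatio_eq_one hB₁ hn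
  have hzero : ∀ t > C, ∀ᶠ n in atTop, filtRatio F n t = 0 := fun t ht => by
    filter_upwards [eventually_ge_atTop 1] with n hn
    exact filtRatio_eq_zero hn (hC n hn) ht
  -- Ratios and tails are identified for n > 0, which is enough for statements at infinity.
  have hev : ∀ {P : ℕ → ℝ → Prop} (t : ℝ), (∀ᶠ n in atTop, P n (filtRatio F n t)) ↔
      ∀ᶠ n in atTop, P n (((F n).scaledMeasure n).real (Set.Ici t)) := by
    intro P t
    refine eventually_congr ?_
    filter_upwards [eventually_gt_atTop 0] with n hn
    rw [scaledMeasure_real_Ici F hn]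
  have hfr : ∀ {q : ℝ} (t : ℝ), (∃ᶠ n in atTop, q < filtRatio F n t) ↔
      ∃ᶠ n in atTop, q < ((F n).scaledMeasure n).real (Set.Ici t) := by
    intro q t
    exact not_congr (hev (P := fun _ x => ¬ q < x) t)
  obtain ⟨ν, hν, hvague, hlow, hupp⟩ := exists_probabilityMeasure_limit
    (fun n => (F n).scaledMeasure n) (a := a) (b := C + 1)
    ((hev (P := fun _ x => x = 1) a).1 hone)
    ((hev (P := fun _ x => x = 0) (C + 1)).1 (hzero _ (by linarith)))
    (fun τ t q q' hτ hq h => (hev (P := fun _ x => q' < x) τ).1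
      (frequently_lt_filtRatio hgen hB₁ hf hF hτ hq ((hfr t).2 h)))
  have hlow' : ∀ τ t q, τ < t → q < ν.real (Set.Ici t) → ∀ᶠ n in atTop, q < filtRatio F n τ :=
    fun τ t q hτ hq => (hev (P := fun _ x => q < x) τ).2 (hlow τ t q hτ hq)
  have hupp' : ∀ t q, (∃ᶠ n in atTop, q < filtRatio F n t) → q ≤ ν.real (Set.Ici t) :=
    fun t q h => hupp t q ((hfr t).1 h)
  refine ⟨ν, hν, hvague, hlow', hupp', fun φ hφ =>
    integrable_of_measure_Icc_compl (a := a) (b := C + 2) ?_ hφ⟩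
  have h1 : ∀ᵐ x ∂ν, a ≤ x := by
    refine ae_ge_of_measureReal_Ici_eq_one (le_of_forall_lt fun q hq => ?_)
    obtain ⟨q', hq1, hq2⟩ := exists_between hq
    refine hq1.trans_le (hupp' a q' (Eventually.frequently ?_))
    filter_upwards [hone] with n hn
    rwa [hn]
  -- `hlow'` moves strictly to the left, here from C + 2 to C + 1, where the ratios already vanish.
  have h2 : ∀ᵐ x ∂ν, x < C + 2 := by
    have h3 : ν.real (Set.Ici (C + 2)) = 0 := by
      by_contra hne
      have hpos : 0 < ν.real (Set.Ici (C + 2)) := lt_of_le_of_ne measureReal_nonneg (Ne.symm hne)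
      obtain ⟨n, hn, hn'⟩ := ((hlow' (C + 1) (C + 2) 0 (by linarith) hpos).and
        (hzero (C + 1) (by linarith))).exists
      exact absurd hn' hn.ne'
    rw [measureReal_eq_zero_iff] at h3
    rw [ae_iff]
    refine measure_mono_null (fun x hx => ?_) h3
    exact not_lt.1 hx
  have h3 : ∀ᵐ x ∂ν, x ∈ Set.Icc a (C + 2) := by
    filter_upwards [h1, h2] with x hx1 hx2 using ⟨hx1, hx2.le⟩
  exact h3

-- Since B_(km) is the k-th power of B_m, a lower slope bound at the single level m passes to all
-- its multiples.
omit [IsDomain B] in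
theorem filtPiece_mul_of_eq (hgen : Algebra.adjoin K (𝓑 1 : Set B) = ⊤)
    {f : ℕ → ℝ} {n₀ : ℕ} {F : ∀ n, RFiltration K (𝓑 n)} (hF : QuasiFilteredFrom 𝓑 f n₀ F)
    {m k : ℕ} (hm : n₀ ≤ m) (hk : 2 ≤ k) {t : ℝ} (h : filtPiece F m t = 𝓑 m) :
    filtPiece F (k * m) (k * (t - f m)) = 𝓑 (k * m) := by
  refine le_antisymm (filtPiece_le F _ _) ?_
  have h1 := hF.pow_mul_pow_le (p := m) (q := m) (k := k) (M := 0) (N := k * m) hm hm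
    (by omega) (by omega) t t
  rw [h, pow_zero, mul_one, gradedPiece_eq_pow 𝓑 hgen m, ← pow_mul, mul_comm m k,
    ← gradedPiece_eq_pow 𝓑 hgen] at h1
  simpa using h1

end Limit

/-! ### The semicontinuity theorem -/

theorem mainTheorem11 {K B : Type*} [Field K] [Infinite K] [CommRing B] [IsDomain B]
    [Algebra K B] [Algebra.FiniteType K B]
    (𝓑 : ℕ → Submodule K B) [GradedAlgebra 𝓑] [∀ n, FiniteDimensional K (𝓑 n)]
    (hB₁ : 𝓑 1 ≠ ⊥) (hgen : Algebra.adjoin K (𝓑 1 : Set B) = ⊤)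
    (f : ℕ → ℝ) (hf : Tendsto (fun n : ℕ => f n / (n : ℝ)) atTop (𝓝 0))
    (F : ∀ n, RFiltration K (𝓑 n)) (F' : ℕ → ∀ n, RFiltration K (𝓑 n))
    (hF : ∃ n₀ : ℕ, QuasiFilteredFrom 𝓑 f n₀ F)
    (hF' : ∃ n₀ : ℕ, ∀ m, QuasiFilteredFrom 𝓑 f n₀ (F' m))
    (hmax : ∃ C : ℝ, ∀ n : ℕ, 1 ≤ n → ∀ x : 𝓑 n, x ≠ 0 →
      (F n).lam x ≤ ((C * n : ℝ) : EReal))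
    (hmax' : ∀ m : ℕ, ∃ C : ℝ, ∀ n : ℕ, 1 ≤ n → ∀ x : 𝓑 n, x ≠ 0 →
      (F' m n).lam x ≤ ((C * n : ℝ) : EReal))
    (hsub : ∀ m : ℕ, 1 ≤ m → ∀ t : ℝ, (F m).sub t ≤ (F' m m).sub t) :
    ∃ (ν : Measure ℝ) (ν' : ℕ → Measure ℝ),
      (IsProbabilityMeasure ν ∧ VaguelyConverges (fun n => (F n).scaledMeasure n) ν) ∧
      (∀ m, IsProbabilityMeasure (ν' m) ∧
        VaguelyConverges (fun n => (F' m n).scaledMeasure n) (ν' m)) ∧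
      ∀ φ : ℝ → ℝ, Monotone φ → ConcaveOn ℝ Set.univ φ → (∃ L : NNReal, LipschitzWith L φ) →
        Integrable φ ν ∧ (∀ m, Integrable φ (ν' m)) ∧
        ((∫ x, φ x ∂ν : ℝ) : EReal) ≤
          limsup (fun m : ℕ => ((∫ x, φ x ∂(ν' m) : ℝ) : EReal)) atTop := by
  obtain ⟨n₁, hF⟩ := hF
  obtain ⟨n₂, hF'⟩ := hF'
  obtain ⟨ν, hν, hvague, hlow, hupp, hint⟩ := exists_limit_scaledMeasure hgen hB₁ hf hF hmax
  choose ν' hν' hvague' hlow' hupp' hint' using fun m =>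
    exists_limit_scaledMeasure hgen hB₁ hf (hF' m) (hmax' m)
  refine ⟨ν, ν', ⟨hν, hvague⟩, fun m => ⟨hν' m, hvague' m⟩, fun φ hmono _ ⟨L, hL⟩ =>
    ⟨hint φ hL.continuous, fun m => hint' m φ hL.continuous, ?_⟩⟩
  obtain ⟨a, ha⟩ := hF.exists_lower_bound hgen
  -- The inclusion at level m hands the lower slope bound of F to F^(m), with the same a for all
  -- large m; p₀ can therefore be chosen before m.
  have haF' : ∀ᶠ m : ℕ in atTop, filtPiece (F' m) m (a * m) = 𝓑 m := by
    filter_upwards [ha, eventually_ge_atTop 1] with m hm hm1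
    rw [filtPiece_eq_iff] at hm ⊢
    exact top_le_iff.1 (hm.symm.le.trans (hsub m hm1 _))
  have hae : ∀ {ρ : Measure ℝ} [IsProbabilityMeasure ρ] {G : ∀ n, RFiltration K (𝓑 n)} {c : ℝ},
      (∀ t q, (∃ᶠ n in atTop, q < filtRatio G n t) → q ≤ ρ.real (Set.Ici t)) →
      (∃ᶠ n in atTop, filtRatio G n c = 1) → ∀ᵐ x ∂ρ, c ≤ x := by
    intro ρ _ G c h hc
    refine ae_ge_of_measureReal_Ici_eq_one (le_of_forall_lt fun q hq => ?_)
    obtain ⟨q', hq1, hq2⟩ := exists_between hq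
    exact hq1.trans_le (h c q' (hc.mono fun n hn => by rwa [hn]))
  refine integral_le_limsup_of_Ici ?_ hL.continuous hmono (hint φ hL.continuous)
    (fun m => hint' m φ hL.continuous) (a := a - 1) ?_ ?_
  · intro τ t q hτ hq
    -- The move from t to t' pays for passing from ν to level m of F, that from t' to τ for passing
    -- from level m of F^(m) to ν^(m).
    obtain ⟨t', h1, h2⟩ := exists_between hτ
    have hqtop : q ≠ ⊤ := (hq.trans_le le_top).ne
    have hq' : q.toReal < ν.real (Set.Ici t) :=
      (ENNReal.toReal_lt_toReal hqtop (measure_ne_top _ _)).2 hq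
    obtain ⟨r, hr1, hr2⟩ := exists_between hq'
    obtain ⟨p₀, hp₀⟩ := exists_forall_eventually_lt_filtRatio (𝓑 := 𝓑) hgen hB₁ hf n₂ a h1 hr1
    filter_upwards [hlow t' t r h2 hr2, haF', eventually_ge_atTop p₀, eventually_ge_atTop 1]
      with m hm ham hmp hm1
    have hle : filtRatio F m t' ≤ filtRatio (F' m) m t' := by
      unfold filtRatio filtDim
      gcongr
      exact Submodule.finrank_mono (Submodule.map_mono (hsub m hm1 _))
    have h3 := hp₀ m hmp (F' m) (hF' m) ham (hm.trans_le hle)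
    rw [← ENNReal.ofReal_toReal hqtop]
    exact ENNReal.ofReal_le_of_le_toReal (hupp' m τ _ h3.frequently)
  · refine hae hupp (Eventually.frequently ?_)
    filter_upwards [ha] with n hn
    refine filtRatio_eq_one hB₁ (le_antisymm (filtPiece_le F _ _) (hn.symm.le.trans ?_))
    exact filtPiece_mono F n (by gcongr; linarith)
  · filter_upwards [haF', hf.eventually (gt_mem_nhds one_pos), eventually_ge_atTop (n₂ + 1)]
      with m hm hfm hmn
    refine hae (hupp' m) (frequently_atTop.2 fun N => ⟨(N + 2) * m, ?_, ?_⟩)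
    · nlinarith
    · have h1 := filtPiece_mul_of_eq hgen (hF' m) (k := N + 2) (by omega) (by omega) hm
      refine filtRatio_eq_one hB₁ (le_antisymm (filtPiece_le _ _ _) (h1.symm.le.trans ?_))
      refine filtPiece_mono _ _ ?_
      have hm0 : (0 : ℝ) < m := by exact_mod_cast (by omega : 0 < m)
      rw [div_lt_one hm0] at hfm
      push_cast
      have h2 : (0 : ℝ) ≤ N + 2 := by positivity
      nlinarith [mul_nonneg h2 (sub_nonneg.2 hfm.le)]
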